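/- Let $\mathbb T=\mathbb R/2\pi\mathbb Z$, let $L^2(\mathbb T)$ be the space of complex square-integrable functions with $\|u\|_{L^2}^2=\int_{\mathbb T}|u(x)|^2\,dx$, and for $u\in L^2(\mathbb T)$, $n\in\mathbb Z$ put $\hat u(n)=\frac1{2\pi}\int_{\mathbb T}e^{-inx}u(x)\,dx$. For $t\in\mathbb R$ let $T_t:L^2(\mathbb T)\to L^2(\mathbb T)$ be the Fourier multiplier operator $\widehat{T_tu}(n)=e^{-in^2t}\hat u(n)$. For $B>0$ define $$W_B(u)=\int_0^B\int_{\mathbb T}|T_tu(x)|^4\,dx\,dt,\qquad J_{B,1}=\sup\{W_B(u):u\in L^2(\mathbb T),\ \|u\|_{L^2}^2=1\},$$ and call $u_0\in L^2(\mathbb T)$ a maximizer for $J_{B,1}$ if $\|u_0\|_{L^2}^2=1$ and $W_B(u_0)=J_{B,1}$. Let also $$D_B(u)=2\pi\sum_{l\ne0}\ \sum_{n}\ \sum_{p\neq0}\hat u(n)\,\overline{\hat u(n-l)}\,\overline{\hat u(n-p)}\,\hat u(n-p-l)\int_0^Be^{-2ilpt}\,dt,$$ the sums being over integers $l,n,p$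 (the triple series converges absolutely and its sum is real), and $$A_B(u)=\frac{D_B(u)}{2\pi B}-\sum_{n\in\mathbb Z}|\hat u(n)|^4 .$$ Let $B>0$ be given. (i) If there exists $w\in L^2(\mathbb T)$ with $A_B(w)>0$, then $B/\pi<J_{B,1}<\infty$, and there exists a maximizer for $J_{B,1}$ in $L^2(\mathbb T)$. (ii) If $A_B(u)<0$ for all $u\in L^2(\mathbb T)$ with $u\ne0$, then $J_{B,1}=B/\pi$, and there do not exist any maximizers for $J_{B,1}$ in $L^2(\mathbb T)$. -/

import Mathlib

open MeasureTheory
open scoped Real ENNReal ComplexConjugate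

namespace PeriodicStrichartz

instance twoPiPos : Fact (0 < 2 * π) := ⟨Real.two_pi_pos⟩

/-- The torus `𝕋 = ℝ / 2πℤ`; its `volume` is the Lebesgue measure, of total mass `2π`. -/
abbrev Torus : Type := AddCircle (2 * π)

/-- The complex Hilbert space `L²(𝕋)`, with `‖u‖² = ∫_𝕋 |u(x)|² dx` (no normalising factor). -/
abbrev L2T : Type := Lp ℂ 2 (volume : Measure Torus)

/-- The Fourier coefficient `û(n) = (1/2π) ∫_𝕋 e^{-inx} u(x) dx`. -/
noncomputable def fhat (u : L2T) (n : ℤ) : ℂ := fourierCoeff (u : Torus → ℂ) n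

theorem fhat_eq_integral (u : L2T) (n : ℤ) :
    fhat u n = (1 / (2 * π) : ℝ) •
      ∫ x in (0 : ℝ)..(2 * π), Complex.exp (-(Complex.I * n * x)) * u (x : Torus) := by
  rw [fhat, fourierCoeff_eq_intervalIntegral _ _ 0, zero_add]
  congr 1
  refine intervalIntegral.integral_congr fun x _ => ?_
  have hpi : (π : ℂ) ≠ 0 := by exact_mod_cast Real.pi_ne_zero
  simp only [fourier_coe_apply, smul_eq_mul]
  congr 2
  push_cast
  field_simp

/-- `u` as an element of the `L²` space of the normalised Haar measure, where Mathlib keeps its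
Fourier basis. -/
noncomputable def toHaar (u : L2T) : Lp ℂ 2 (AddCircle.haarAddCircle (T := 2 * π)) :=
  (Lp.memLp u).haarAddCircle.toLp u

/-- The inverse identification. -/
noncomputable def ofHaar (v : Lp ℂ 2 (AddCircle.haarAddCircle (T := 2 * π))) : L2T :=
  (Lp.memLp v).of_haarAddCircle.toLp v

theorem ae_volume_iff {P : Torus → Prop} :
    (∀ᵐ x ∂(volume : Measure Torus), P x) ↔ ∀ᵐ x ∂AddCircle.haarAddCircle, P x := by
  rw [AddCircle.volume_eq_smul_haarAddCircle]
  exact Measure.ae_ennreal_smul_measure_iff (ENNReal.ofReal_pos.2 Real.two_pi_pos).ne'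

theorem repr_toHaar (u : L2T) (n : ℤ) : fourierBasis.repr (toHaar u) n = fhat u n := by
  rw [fourierBasis_repr, fhat]
  exact congrFun (fourierCoeff_congr_ae (MemLp.coeFn_toLp (Lp.memLp u).haarAddCircle)) n

theorem fhat_ofHaar (v : Lp ℂ 2 (AddCircle.haarAddCircle (T := 2 * π))) (n : ℤ) :
    fhat (ofHaar v) n = fourierBasis.repr v n := by
  rw [fourierBasis_repr, fhat]
  exact congrFun (fourierCoeff_congr_ae
    (ae_volume_iff.1 (MemLp.coeFn_toLp (Lp.memLp v).of_haarAddCircle))) n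

/-- The multiplier `e^{-in²t}` applied to a sequence in `ℓ²(ℤ)`. -/
noncomputable def phaseMul (t : ℝ) (a : lp (fun _ : ℤ => ℂ) 2) : lp (fun _ : ℤ => ℂ) 2 :=
  ⟨fun n => Complex.exp (-(Complex.I * (n : ℂ) ^ 2 * t)) * a n, by
    refine (lp.memℓp a).mono' fun n => ?_
    have h : -(Complex.I * (n : ℂ) ^ 2 * t) = ((-((n : ℝ) ^ 2 * t) : ℝ) : ℂ) * Complex.I := by
      push_cast; ring
    rw [norm_mul, h, Complex.norm_exp_ofReal_mul_I, one_mul]⟩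

/-- The free Schrödinger evolution `T_t` on `L²(𝕋)`, the Fourier multiplier operator with symbol
`e^{-in²t}` (see `fhat_evol`). -/
noncomputable def evol (t : ℝ) (u : L2T) : L2T :=
  ofHaar (fourierBasis.repr.symm (phaseMul t (fourierBasis.repr (toHaar u))))

theorem fhat_evol (t : ℝ) (u : L2T) (n : ℤ) :
    fhat (evol t u) n = Complex.exp (-(Complex.I * (n : ℂ) ^ 2 * t)) * fhat u n := by
  rw [evol, fhat_ofHaar, LinearIsometryEquiv.apply_symm_apply, ← repr_toHaar]
  rfl

/-- Fourier coefficients determine the function, so `fhat_evol` characterises `evol`. -/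
theorem eq_of_fhat_eq {u v : L2T} (h : ∀ n, fhat u n = fhat v n) : u = v := by
  have h1 : toHaar u = toHaar v := by
    apply fourierBasis.repr.injective
    ext n
    rw [repr_toHaar, repr_toHaar, h]
  have h2 : (u : Torus → ℂ) =ᵐ[AddCircle.haarAddCircle] v :=
    (MemLp.toLp_eq_toLp_iff _ _).1 h1
  exact Lp.ext (ae_volume_iff.2 h2)

/-- `W_B(u) = ∫_0^B ∫_𝕋 |T_t u(x)|⁴ dx dt`, as an element of `[0, ∞]`. -/
noncomputable def W (B : ℝ) (u : L2T) : ℝ≥0∞ :=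
  ∫⁻ t in Set.Icc 0 B, ∫⁻ x : Torus, ‖evol t u x‖ₑ ^ 4

/-- `J_{B,λ} = sup { W_B(u) : ‖u‖²_{L²} = λ }`. -/
noncomputable def J (B lam : ℝ) : ℝ≥0∞ :=
  sSup (W B '' {u : L2T | ‖u‖ ^ 2 = lam})

/-- `u` is a maximizer for `J_{B,λ}`. -/
def IsMaximizer (B lam : ℝ) (u : L2T) : Prop :=
  ‖u‖ ^ 2 = lam ∧ W B u = J B lam

/-- The summand of `D_B(u)` with indices `l`, `n`, `p`. -/
noncomputable def dTerm (B : ℝ) (u : L2T) (l n p : ℤ) : ℂ :=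
  fhat u n * conj (fhat u (n - l)) * conj (fhat u (n - p)) * fhat u (n - p - l) *
    ∫ t in (0 : ℝ)..B, Complex.exp (-(2 * Complex.I * l * p * t))

/-- `D_B(u)`, the sum (times `2π`) over all integers `l ≠ 0`, `n`, `p ≠ 0`. It converges absolutely
(`summable_dTerm`) and is a real number (`D_im`). -/
noncomputable def D (B : ℝ) (u : L2T) : ℂ :=
  2 * π * ∑' q : {l : ℤ // l ≠ 0} × ℤ × {p : ℤ // p ≠ 0}, dTerm B u q.1 q.2.1 q.2.2

/-- `A_B(u) = D_B(u) / (2πB) - ‖û‖⁴_{ℓ⁴}`. -/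
noncomputable def A (B : ℝ) (u : L2T) : ℝ :=
  (D B u).re / (2 * π * B) - ∑' n : ℤ, ‖fhat u n‖ ^ 4

theorem summable_sq_fhat (u : L2T) : Summable fun n => ‖fhat u n‖ ^ 2 := by
  have h := (lp.memℓp (fourierBasis.repr (toHaar u))).summable (by norm_num)
  simpa [repr_toHaar] using h

theorem summable_fourth_fhat (u : L2T) : Summable fun n => ‖fhat u n‖ ^ 4 := by
  have h := summable_sq_fhat u
  refine Summable.of_nonneg_of_le (fun n => by positivity) (fun n => ?_)
    (h.mul_right (∑' n, ‖fhat u n‖ ^ 2))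
  have h1 := h.le_tsum n fun _ _ => by positivity
  nlinarith [sq_nonneg ‖fhat u n‖]

theorem norm_integral_exp_le (B : ℝ) {l p : ℤ} (hl : l ≠ 0) (hp : p ≠ 0) :
    ‖∫ t in (0 : ℝ)..B, Complex.exp (-(2 * Complex.I * l * p * t))‖
      ≤ ((l : ℝ) ^ 2)⁻¹ + ((p : ℝ) ^ 2)⁻¹ := by
  have hl' : (l : ℂ) ≠ 0 := by exact_mod_cast hl
  have hp' : (p : ℂ) ≠ 0 := by exact_mod_cast hp
  have hc : -(2 * Complex.I * l * p) ≠ 0 := by simp [hl', hp']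
  have e : ∀ s : ℝ, ‖Complex.exp (-(2 * Complex.I * l * p) * s)‖ = 1 := fun s => by
    have : -(2 * Complex.I * l * p) * s = ((-(2 * l * p * s) : ℝ) : ℂ) * Complex.I := by
      push_cast; ring
    rw [this, Complex.norm_exp_ofReal_mul_I]
  have h1 : ∀ t : ℝ, -(2 * Complex.I * l * p * t) = -(2 * Complex.I * l * p) * t :=
    fun t => by ring
  simp_rw [h1]
  rw [integral_exp_mul_complex hc, norm_div]
  have hn : ‖-(2 * Complex.I * l * p)‖ = 2 * (|(l : ℝ)| * |(p : ℝ)|) := by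
    simp [mul_assoc]
  have hl0 : 0 < |(l : ℝ)| := by simpa using hl
  have hp0 : 0 < |(p : ℝ)| := by simpa using hp
  have h2 : ‖Complex.exp (-(2 * Complex.I * l * p) * B)
      - Complex.exp (-(2 * Complex.I * l * p) * (0 : ℝ))‖ ≤ 2 := by
    refine (norm_sub_le _ _).trans ?_
    rw [e, e]; norm_num
  rw [hn, div_le_iff₀ (by positivity)]
  refine h2.trans ?_
  rw [← sq_abs (l : ℝ), ← sq_abs (p : ℝ)]
  have h3 : ((|(l : ℝ)| ^ 2)⁻¹ + (|(p : ℝ)| ^ 2)⁻¹) * (2 * (|(l : ℝ)| * |(p : ℝ)|))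
      = 2 * (|(p : ℝ)| / |(l : ℝ)| + |(l : ℝ)| / |(p : ℝ)|) := by
    field_simp
  rw [h3]
  have h4 : 1 ≤ |(p : ℝ)| / |(l : ℝ)| + |(l : ℝ)| / |(p : ℝ)| := by
    rw [div_add_div _ _ hl0.ne' hp0.ne', le_div_iff₀ (by positivity)]
    nlinarith [sq_nonneg (|(p : ℝ)| - |(l : ℝ)|), mul_pos hl0 hp0]
  linarith

theorem summable_aux (a : ℤ → ℝ) (ha : ∀ n, 0 ≤ a n) (hs : Summable fun n => a n ^ 2) :
    Summable fun q : ℤ × ℤ × ℤ => ((q.1 : ℝ) ^ 2)⁻¹ *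
      (a q.2.1 * a (q.2.1 - q.1) * (a (q.2.1 - q.2.2) * a (q.2.1 - q.2.2 - q.1))) := by
  set F : ℤ → ℤ → ℝ := fun l n => a n * a (n - l) with hF
  have hs' : ∀ l : ℤ, Summable fun n => a (n - l) ^ 2 := fun l =>
    (Equiv.subRight l).summable_iff.2 hs
  have hts : ∀ l : ℤ, ∑' n, a (n - l) ^ 2 = ∑' n, a n ^ 2 := fun l =>
    (Equiv.subRight l).tsum_eq fun n => a n ^ 2
  have hF0 : ∀ l n, 0 ≤ F l n := fun l n => mul_nonneg (ha _) (ha _)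
  have hFle : ∀ l n, F l n ≤ (a n ^ 2 + a (n - l) ^ 2) / 2 := fun l n => by
    simp only [hF]; nlinarith [sq_nonneg (a n - a (n - l))]
  have hFs : ∀ l, Summable (F l) := fun l =>
    Summable.of_nonneg_of_le (hF0 l) (hFle l) ((hs.add (hs' l)).div_const 2)
  have hFt : ∀ l, ∑' n, F l n ≤ ∑' n, a n ^ 2 := fun l => by
    refine ((hFs l).tsum_le_tsum (hFle l) ((hs.add (hs' l)).div_const 2)).trans ?_
    rw [tsum_div_const, hs.tsum_add (hs' l), hts]
    linarith
  have hFF : ∀ l, Summable fun r : ℤ × ℤ => F l r.1 * F l r.2 := fun l =>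
    (hFs l).mul_of_nonneg (hFs l) (hF0 l) (hF0 l)
  have key : Summable fun q : ℤ × ℤ × ℤ =>
      ((q.1 : ℝ) ^ 2)⁻¹ * (F q.1 q.2.1 * F q.1 q.2.2) := by
    have h0 : 0 ≤ fun q : ℤ × ℤ × ℤ =>
        ((q.1 : ℝ) ^ 2)⁻¹ * (F q.1 q.2.1 * F q.1 q.2.2) := fun q =>
      mul_nonneg (by positivity) (mul_nonneg (hF0 _ _) (hF0 _ _))
    have hc : ∀ l : ℤ, Summable fun r : ℤ × ℤ => ((l : ℝ) ^ 2)⁻¹ * (F l r.1 * F l r.2) :=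
      fun l => (hFF l).mul_left _
    refine (summable_prod_of_nonneg h0).2 ⟨hc, ?_⟩
    have hl : Summable fun l : ℤ => ((l : ℝ) ^ 2)⁻¹ := by
      simpa using Real.summable_one_div_int_pow.2 (one_lt_two)
    refine Summable.of_nonneg_of_le (fun l => tsum_nonneg fun r =>
      mul_nonneg (by positivity) (mul_nonneg (hF0 _ _) (hF0 _ _))) (fun l => ?_)
      (hl.mul_right ((∑' n, a n ^ 2) ^ 2))
    change ∑' y : ℤ × ℤ, ((l : ℝ) ^ 2)⁻¹ * (F l y.1 * F l y.2) ≤ _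
    rw [tsum_mul_left, ← (hFs l).tsum_mul_tsum (hFs l) (hFF l), ← sq]
    have h5 : 0 ≤ ∑' n, F l n := tsum_nonneg (hF0 l)
    exact mul_le_mul_of_nonneg_left (pow_le_pow_left₀ h5 (hFt l) 2) (by positivity)
  let e : ℤ × ℤ × ℤ ≃ ℤ × ℤ × ℤ :=
    { toFun := fun q => (q.1, q.2.1, q.2.1 - q.2.2)
      invFun := fun q => (q.1, q.2.1, q.2.1 - q.2.2)
      left_inv := fun q => by ext <;> simp
      right_inv := fun q => by ext <;> simp }
  refine (e.summable_iff.2 key).congr fun q => ?_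
  simp only [Function.comp, e, Equiv.coe_fn_mk, hF]

/-- The series defining `D_B(u)` converges absolutely. -/
theorem summable_dTerm (B : ℝ) (u : L2T) :
    Summable fun q : {l : ℤ // l ≠ 0} × ℤ × {p : ℤ // p ≠ 0} =>
      ‖dTerm B u q.1 q.2.1 q.2.2‖ := by
  have h1 := summable_aux (fun n => ‖fhat u n‖) (fun _ => norm_nonneg _) (summable_sq_fhat u)
  let e : ℤ × ℤ × ℤ ≃ ℤ × ℤ × ℤ :=
    { toFun := fun q => (q.2.2, q.2.1, q.1)
      invFun := fun q => (q.2.2, q.2.1, q.1)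
      left_inv := fun _ => rfl
      right_inv := fun _ => rfl }
  have h2 := h1.add (e.summable_iff.2 h1)
  let i : {l : ℤ // l ≠ 0} × ℤ × {p : ℤ // p ≠ 0} → ℤ × ℤ × ℤ :=
    fun q => (q.1.1, q.2.1, q.2.2.1)
  have hi : Function.Injective i := fun q r h => by
    simp only [i, Prod.mk.injEq] at h
    exact Prod.ext (Subtype.ext h.1) (Prod.ext h.2.1 (Subtype.ext h.2.2))
  refine Summable.of_nonneg_of_le (fun _ => norm_nonneg _) (fun q => ?_) (h2.comp_injective hi)
  obtain ⟨⟨l, hl⟩, n, ⟨p, hp⟩⟩ := q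
  have hb := norm_integral_exp_le B hl hp
  simp only [dTerm, norm_mul, RCLike.norm_conj, Function.comp, i, e, Equiv.coe_fn_mk]
  have h3 : n - l - p = n - p - l := by ring
  rw [h3]
  refine (mul_le_mul_of_nonneg_left hb (by positivity)).trans (le_of_eq ?_)
  ring

theorem conj_dTerm (B : ℝ) (u : L2T) (l n p : ℤ) :
    conj (dTerm B u l n p) = dTerm B u l (n - p) (-p) := by
  have h1 : n - p - -p = n := by ring
  have h2 : conj (∫ t in (0 : ℝ)..B, Complex.exp (-(2 * Complex.I * l * p * t)))
      = ∫ t in (0 : ℝ)..B, Complex.exp (-(2 * Complex.I * l * ((-p : ℤ) : ℂ) * t)) := by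
    rw [← intervalIntegral.intervalIntegral_conj]
    refine intervalIntegral.integral_congr fun t _ => ?_
    have h3 : conj (2 : ℂ) = 2 := Complex.conj_ofNat 2
    simp [← Complex.exp_conj, h3]
  simp only [dTerm, map_mul, h1, h2, Complex.conj_conj]
  ring

/-- `D_B(u)` is a real number. -/
theorem D_im (B : ℝ) (u : L2T) : (D B u).im = 0 := by
  rw [← Complex.conj_eq_iff_im, D, map_mul, Complex.conj_tsum]
  simp_rw [conj_dTerm]
  let e : {l : ℤ // l ≠ 0} × ℤ × {p : ℤ // p ≠ 0} ≃ {l : ℤ // l ≠ 0} × ℤ × {p : ℤ // p ≠ 0} :=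
    { toFun := fun q => (q.1, q.2.1 - q.2.2, ⟨-q.2.2.1, neg_ne_zero.2 q.2.2.2⟩)
      invFun := fun q => (q.1, q.2.1 - q.2.2, ⟨-q.2.2.1, neg_ne_zero.2 q.2.2.2⟩)
      left_inv := fun q => by ext <;> simp
      right_inv := fun q => by ext <;> simp }
  have h := e.tsum_eq fun q => dTerm B u q.1 q.2.1 q.2.2
  rw [← h]
  have h2 : conj (2 * (π : ℂ)) = 2 * π := by
    rw [map_mul, Complex.conj_ofReal, Complex.conj_ofNat]
  rw [h2]
  simp only [e, Equiv.coe_fn_mk]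

end PeriodicStrichartz

/-!
Write `a n = û(n)`, so that `‖u‖² = 2π M` with `M = ∑ |a n|²`. The `l`-th Fourier coefficient of
`|T_t u|²` is `∑ a n conj(a (n - l)) e^{-it(n² - (n - l)²)}`; Parseval's identity, integrated over
`[0, B]`, turns `W_B(u)` into a sum over the parallelograms `n, n - l, n - p, n - p - l`. Those with
`l = 0` and those with `p = 0` contribute `M²` each, and the overlap is `∑ |a n|⁴`, which gives
`W_B(u) = (B/π) ‖u‖⁴ + 2πB A_B(u)` (`W_eq`, `A_eq_quartic`). For a fixed `t` the function `T_t u`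
need not lie in `L⁴`, so Parseval is proved in `[0, ∞]` for merely integrable functions
(`lintegral_enorm_sq_eq_tsum`). The question becomes whether `sup A_B` over the unit sphere is
positive and attained.

Here `A_B` is a quartic form `Re ∑ κ(l, p) G(l, p)` in which `G(l, p)` sums the products of the four
entries at the corners of a parallelogram with sides `l` and `p`, and `κ` is square-summable on `ℤ²`
because an oscillatory integral with frequency `2lp` is at most `1 / |lp|`. Three corners determine
the fourth, so Cauchy–Schwarz gives `∑ |G|² ≤ M⁴` (`mass_corr_le`). Hence `A_B` is bounded on the
sphere, and `A_B` of a sequence of functions is controlled by the pointwise behaviour of `G`.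

Suppose `S = sup A_B > 0` on the sphere `M = 1`. Translate a maximizing sequence so that its largest
entry is at `0`, and let `a` be a pointwise limit. If `a` vanished at `0` the sequence would vanish
uniformly, so `G → 0` and `S = 0`. The functional decouples along `a + b k` when `b k → 0` pointwise
(`tendsto_quartic_decoupling`), so with `m = M(a) > 0` one gets `S ≤ S (m² + (1 - m)²)`. This forces
`m = 1`, and `a` is a maximizer (`exists_quartic_maximizer`).

If `A_B < 0` away from `0`, then every `W_B(u)` on the sphere is below `B/π`. That this is still the
supremum is seen on sequences constant on `N` powers of two: these form a Sidon set, so there is no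
nondegenerate parallelogram, and `A_B` is a multiple of `-1/N` (`quartic_lacunary`).
-/

open Filter Topology

namespace PeriodicStrichartz

/-! ### Square-summable families -/

/-- The squared `ℓ²` norm `∑ |a i|²` of a family; it is only meaningful (and only used) when the
series converges. -/
noncomputable def mass {ι : Type*} (a : ι → ℂ) : ℝ := ∑' i, ‖a i‖ ^ 2

theorem mass_nonneg {ι : Type*} (a : ι → ℂ) : 0 ≤ mass a := tsum_nonneg fun _ => by positivity

section SquareSummable

variable {ι : Type*}

theorem summable_norm_mul_norm {f g : ι → ℂ} (hf : Summable fun i => ‖f i‖ ^ 2)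
    (hg : Summable fun i => ‖g i‖ ^ 2) : Summable fun i => ‖f i‖ * ‖g i‖ := by
  refine Summable.of_nonneg_of_le (fun i => by positivity) (fun i => ?_)
    ((hf.add hg).div_const 2)
  nlinarith [sq_nonneg (‖f i‖ - ‖g i‖)]

theorem sq_tsum_norm_mul_norm_le {f g : ι → ℂ} (hf : Summable fun i => ‖f i‖ ^ 2)
    (hg : Summable fun i => ‖g i‖ ^ 2) : (∑' i, ‖f i‖ * ‖g i‖) ^ 2 ≤ mass f * mass g := by
  have h := Real.inner_le_Lp_mul_Lq_tsum_of_nonneg (f := fun i => ‖f i‖) (g := fun i => ‖g i‖)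
    (p := 2) (q := 2) ((Real.holderConjugate_iff).2 ⟨by norm_num, by norm_num⟩)
    (fun _ => norm_nonneg _) (fun _ => norm_nonneg _) (by simpa using hf) (by simpa using hg)
  simp only [Real.rpow_two, ← Real.sqrt_eq_rpow] at h
  have h0 : 0 ≤ ∑' i, ‖f i‖ * ‖g i‖ := tsum_nonneg fun _ => by positivity
  calc (∑' i, ‖f i‖ * ‖g i‖) ^ 2 ≤ (√(mass f) * √(mass g)) ^ 2 := pow_le_pow_left₀ h0 h 2
    _ = mass f * mass g := by
        rw [mul_pow, Real.sq_sqrt (mass_nonneg f), Real.sq_sqrt (mass_nonneg g)]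

theorem tsum_norm_mul_norm_le_sqrt {f g : ι → ℂ} (hf : Summable fun i => ‖f i‖ ^ 2)
    (hg : Summable fun i => ‖g i‖ ^ 2) : ∑' i, ‖f i‖ * ‖g i‖ ≤ √(mass f * mass g) :=
  Real.le_sqrt_of_sq_le (sq_tsum_norm_mul_norm_le hf hg)

theorem summable_sq_add {f g : ι → ℂ} (hf : Summable fun i => ‖f i‖ ^ 2)
    (hg : Summable fun i => ‖g i‖ ^ 2) : Summable fun i => ‖f i + g i‖ ^ 2 := by
  refine Summable.of_nonneg_of_le (fun i => by positivity) (fun i => ?_)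
    ((hf.add hg).mul_left 2)
  have h := pow_le_pow_left₀ (norm_nonneg _) (norm_add_le (f i) (g i)) 2
  nlinarith [sq_nonneg (‖f i‖ - ‖g i‖)]

theorem summable_sq_sub {f g : ι → ℂ} (hf : Summable fun i => ‖f i‖ ^ 2)
    (hg : Summable fun i => ‖g i‖ ^ 2) : Summable fun i => ‖f i - g i‖ ^ 2 := by
  have := summable_sq_add hf (g := fun i => -g i) (by simpa using hg)
  simpa [sub_eq_add_neg] using this

theorem mass_add_le {f g : ι → ℂ} (hf : Summable fun i => ‖f i‖ ^ 2)
    (hg : Summable fun i => ‖g i‖ ^ 2) :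
    mass (fun i => f i + g i) ≤ 2 * (mass f + mass g) := by
  rw [mass, mass, mass, ← hf.tsum_add hg, ← tsum_mul_left]
  refine (summable_sq_add hf hg).tsum_le_tsum (fun i => ?_) ((hf.add hg).mul_left 2)
  have h := pow_le_pow_left₀ (norm_nonneg _) (norm_add_le (f i) (g i)) 2
  nlinarith [sq_nonneg (‖f i‖ - ‖g i‖)]

theorem mass_sub_le {f g : ι → ℂ} (hf : Summable fun i => ‖f i‖ ^ 2)
    (hg : Summable fun i => ‖g i‖ ^ 2) :
    mass (fun i => f i - g i) ≤ 2 * (mass f + mass g) := by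
  have := mass_add_le hf (g := fun i => -g i) (by simpa using hg)
  simpa [sub_eq_add_neg, mass] using this

theorem sq_norm_le_mass {f : ι → ℂ} (hf : Summable fun i => ‖f i‖ ^ 2) (i : ι) :
    ‖f i‖ ^ 2 ≤ mass f := hf.le_tsum i fun _ _ => by positivity

/-- A bounded family in `ℓ²` that tends to `0` pointwise tends to `0` weakly: its pairing with a
fixed element of `ℓ²` tends to `0`, even with absolute values inside. -/
theorem tendsto_tsum_norm_mul_norm {α : Type*} {F : Filter α} {f : ι → ℂ} {g : α → ι → ℂ} {C : ℝ}
    (hf : Summable fun i => ‖f i‖ ^ 2) (hg : ∀ k, Summable fun i => ‖g k i‖ ^ 2)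
    (hC : ∀ k, mass (g k) ≤ C) (h0 : ∀ i, Tendsto (fun k => g k i) F (𝓝 0)) :
    Tendsto (fun k => ∑' i, ‖f i‖ * ‖g k i‖) F (𝓝 0) := by
  have htail : Tendsto (fun s : Finset ι => √((∑' i : {i // i ∉ s}, ‖f i‖ ^ 2) * C))
      atTop (𝓝 0) := by
    have h1 := (tendsto_tsum_compl_atTop_zero fun i => ‖f i‖ ^ 2).mul_const C
    simpa using h1.sqrt
  rw [Metric.tendsto_nhds]
  intro ε hε
  obtain ⟨s, hs⟩ := (htail.eventually (gt_mem_nhds (half_pos hε))).exists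
  have hfin : Tendsto (fun k => ∑ i ∈ s, ‖f i‖ * ‖g k i‖) F (𝓝 0) := by
    have : Tendsto (fun k => ∑ i ∈ s, ‖f i‖ * ‖g k i‖) F (𝓝 (∑ i ∈ s, ‖f i‖ * ‖(0 : ℂ)‖)) :=
      tendsto_finsetSum _ fun i _ => (h0 i).norm.const_mul _
    simpa using this
  filter_upwards [hfin.eventually (gt_mem_nhds (half_pos hε))] with k hk
  have hsum := summable_norm_mul_norm hf (hg k)
  have hf' : Summable fun i : {i // i ∉ s} => ‖f i‖ ^ 2 := hf.subtype _
  have hg' : Summable fun i : {i // i ∉ s} => ‖g k i‖ ^ 2 := (hg k).subtype _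
  have h1 := tsum_norm_mul_norm_le_sqrt hf' hg'
  have h2 : mass (fun i : {i // i ∉ s} => g k i) ≤ C :=
    (Summable.tsum_subtype_le (fun i => ‖g k i‖ ^ 2) {i | i ∉ s} (fun _ => by positivity)
      (hg k)).trans (hC k)
  have h3 : √(mass (fun i : {i // i ∉ s} => f i) * mass (fun i : {i // i ∉ s} => g k i)) ≤
      √((∑' i : {i // i ∉ s}, ‖f i‖ ^ 2) * C) :=
    Real.sqrt_le_sqrt (mul_le_mul_of_nonneg_left h2 (mass_nonneg _))
  have h4 := hsum.sum_add_tsum_subtype_compl s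
  have h5 : 0 ≤ ∑' i, ‖f i‖ * ‖g k i‖ := tsum_nonneg fun _ => by positivity
  rw [Real.dist_eq, sub_zero, abs_of_nonneg h5]
  linarith

/-- The parallelogram-type expansion behind the decoupling of mass: if `b k` is bounded and tends to
`0` pointwise, then `‖a + b k‖² - ‖a‖² - ‖b k‖²` tends to `0`. -/
theorem tendsto_mass_decoupling {α : Type*} {F : Filter α} {a : ι → ℂ} {b : α → ι → ℂ} {C : ℝ}
    (ha : Summable fun i => ‖a i‖ ^ 2) (hb : ∀ k, Summable fun i => ‖b k i‖ ^ 2)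
    (hC : ∀ k, mass (b k) ≤ C) (h0 : ∀ i, Tendsto (fun k => b k i) F (𝓝 0)) :
    Tendsto (fun k => mass (fun i => a i + b k i) - mass a - mass (b k)) F (𝓝 0) := by
  have hw := (tendsto_tsum_norm_mul_norm ha hb hC h0).const_mul 2
  rw [mul_zero] at hw
  refine squeeze_zero_norm (fun k => ?_) hw
  have hs := summable_sq_add ha (hb k)
  have hm := summable_norm_mul_norm ha (hb k)
  have e : mass (fun i => a i + b k i) - mass a - mass (b k) =
      ∑' i, (‖a i + b k i‖ ^ 2 - ‖a i‖ ^ 2 - ‖b k i‖ ^ 2) := by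
    rw [(hs.sub ha).tsum_sub (hb k), hs.tsum_sub ha]; rfl
  rw [e, ← tsum_mul_left]
  refine tsum_of_norm_bounded (hm.mul_left 2).hasSum fun i => ?_
  have h1 := norm_add_le (a i) (b k i)
  have h2 := abs_norm_sub_norm_le (a i) (-b k i)
  rw [sub_neg_eq_add, norm_neg] at h2
  have h3 := pow_le_pow_left₀ (norm_nonneg _) h1 2
  have h4 := pow_le_pow_left₀ (abs_nonneg _) h2 2
  rw [sq_abs] at h4
  rw [Real.norm_eq_abs, abs_le]
  constructor <;> nlinarith

end SquareSummable

/-! ### The quartic correlations -/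

/-- The summand of `corr`. -/
noncomputable def corrTerm (a : ℤ → ℂ) (l p n : ℤ) : ℂ :=
  a n * conj (a (n - l)) * conj (a (n - p)) * a (n - p - l)

/-- The quartic correlation of a sequence with offsets `l` and `p`, summed over the parallelograms
`n, n - l, n - p, n - p - l`. -/
noncomputable def corr (a : ℤ → ℂ) (q : ℤ × ℤ) : ℂ := ∑' n, corrTerm a q.1 q.2 n

theorem summable_sq_shift {a : ℤ → ℂ} (ha : Summable fun n => ‖a n‖ ^ 2) (l : ℤ) :
    Summable fun n => ‖a (n - l)‖ ^ 2 := (Equiv.subRight l).summable_iff.2 ha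

theorem mass_shift (a : ℤ → ℂ) (l : ℤ) : mass (fun n => a (n - l)) = mass a :=
  (Equiv.subRight l).tsum_eq fun n => ‖a n‖ ^ 2

theorem norm_corrTerm (a : ℤ → ℂ) (l p n : ℤ) :
    ‖corrTerm a l p n‖ = ‖a n‖ * ‖a (n - l) * a (n - p) * a (n - p - l)‖ := by
  simp only [corrTerm, norm_mul, RCLike.norm_conj]; ring

/-- The change of variables `(l, p, n) ↦ (n - l, n - p, n - p - l)` is a bijection of `ℤ³`. -/
def cornerEquiv : (ℤ × ℤ) × ℤ ≃ ℤ × ℤ × ℤ where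
  toFun q := (q.2 - q.1.1, q.2 - q.1.2, q.2 - q.1.2 - q.1.1)
  invFun r := ((r.2.1 - r.2.2, r.1 - r.2.2), r.1 + r.2.1 - r.2.2)
  left_inv q := by
    ext
    · simp
    · simp
    · dsimp only; ring
  right_inv r := by ext <;> simp

section Corr

variable {a : ℤ → ℂ}

theorem hasSum_sq_corners (ha : Summable fun n => ‖a n‖ ^ 2) :
    HasSum (fun r : (ℤ × ℤ) × ℤ =>
      ‖a (r.2 - r.1.1) * a (r.2 - r.1.2) * a (r.2 - r.1.2 - r.1.1)‖ ^ 2) (mass a ^ 3) := by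
  have h2 := ha.mul_of_nonneg ha (fun n => by positivity) (fun n => by positivity)
  have h3 := ha.mul_of_nonneg h2 (fun n => by positivity) (fun n => by positivity)
  have key : HasSum (fun r : ℤ × ℤ × ℤ => ‖a r.1‖ ^ 2 * (‖a r.2.1‖ ^ 2 * ‖a r.2.2‖ ^ 2))
      (mass a * (mass a * mass a)) := (ha.hasSum.mul (ha.hasSum.mul ha.hasSum h2) h3)
  have := cornerEquiv.hasSum_iff.2 key
  rw [show mass a ^ 3 = mass a * (mass a * mass a) by ring]
  refine this.congr_fun fun r => ?_
  simp only [Function.comp, cornerEquiv, Equiv.coe_fn_mk, norm_mul]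
  ring

theorem summable_corrTerm (ha : Summable fun n => ‖a n‖ ^ 2) (l p : ℤ) :
    Summable fun n => ‖corrTerm a l p n‖ := by
  simp_rw [norm_corrTerm]
  exact summable_norm_mul_norm ha ((hasSum_sq_corners ha).summable.prod_factor (l, p))

theorem sq_tsum_norm_corrTerm_le (ha : Summable fun n => ‖a n‖ ^ 2) (q : ℤ × ℤ) :
    (∑' n, ‖corrTerm a q.1 q.2 n‖) ^ 2 ≤
      mass a * ∑' n, ‖a (n - q.1) * a (n - q.2) * a (n - q.2 - q.1)‖ ^ 2 := by
  simp_rw [norm_corrTerm]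
  exact sq_tsum_norm_mul_norm_le ha ((hasSum_sq_corners ha).summable.prod_factor q)

theorem sq_norm_corr_le (ha : Summable fun n => ‖a n‖ ^ 2) (q : ℤ × ℤ) :
    ‖corr a q‖ ^ 2 ≤
      mass a * ∑' n, ‖a (n - q.1) * a (n - q.2) * a (n - q.2 - q.1)‖ ^ 2 :=
  (pow_le_pow_left₀ (norm_nonneg _) (norm_tsum_le_tsum_norm (summable_corrTerm ha q.1 q.2)) 2).trans
    (sq_tsum_norm_corrTerm_le ha q)

theorem summable_sq_corr (ha : Summable fun n => ‖a n‖ ^ 2) :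
    Summable fun q => ‖corr a q‖ ^ 2 :=
  Summable.of_nonneg_of_le (fun _ => by positivity) (sq_norm_corr_le ha)
    ((hasSum_sq_corners ha).summable.prod.mul_left _)

/-- The quartic correlations of an `ℓ²` sequence form an `ℓ²` family on `ℤ²`. By Cauchy–Schwarz in
`n`, this reduces to the fact that three corners of a parallelogram determine the fourth. -/
theorem mass_corr_le (ha : Summable fun n => ‖a n‖ ^ 2) : mass (corr a) ≤ mass a ^ 4 := by
  have hs := (hasSum_sq_corners ha).summable
  calc mass (corr a) ≤ ∑' q : ℤ × ℤ,
        mass a * ∑' n, ‖a (n - q.1) * a (n - q.2) * a (n - q.2 - q.1)‖ ^ 2 :=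
        (summable_sq_corr ha).tsum_le_tsum (sq_norm_corr_le ha) (hs.prod.mul_left _)
    _ = mass a * mass a ^ 3 := by
        rw [tsum_mul_left, ← (hasSum_sq_corners ha).tsum_eq, hs.tsum_prod]
    _ = mass a ^ 4 := by ring

theorem norm_corr_le_of_bound (ha : Summable fun n => ‖a n‖ ^ 2) {R : ℝ} (hR : ∀ n, ‖a n‖ ≤ R)
    (q : ℤ × ℤ) : ‖corr a q‖ ≤ R ^ 2 * mass a := by
  have hR0 : 0 ≤ R := (norm_nonneg _).trans (hR 0)
  have hl := summable_sq_shift ha q.1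
  have hm := summable_norm_mul_norm ha hl
  have h1 : ‖corr a q‖ ≤ R ^ 2 * ∑' n, ‖a n‖ * ‖a (n - q.1)‖ := by
    rw [← tsum_mul_left]
    refine tsum_of_norm_bounded (hm.mul_left (R ^ 2)).hasSum fun n => ?_
    simp only [corrTerm, norm_mul, RCLike.norm_conj]
    have h2 := mul_le_mul (hR (n - q.2)) (hR (n - q.2 - q.1)) (norm_nonneg _) hR0
    have h3 : 0 ≤ ‖a n‖ * ‖a (n - q.1)‖ := by positivity
    nlinarith
  have h4 : ∑' n, ‖a n‖ * ‖a (n - q.1)‖ ≤ mass a := by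
    refine (tsum_norm_mul_norm_le_sqrt ha hl).trans (le_of_eq ?_)
    rw [mass_shift, ← sq, Real.sqrt_sq (mass_nonneg a)]
  exact h1.trans (mul_le_mul_of_nonneg_left h4 (by positivity))

theorem corr_shift (a : ℤ → ℂ) (m : ℤ) (q : ℤ × ℤ) : corr (fun n => a (n - m)) q = corr a q := by
  rw [corr, corr, ← (Equiv.subRight m).tsum_eq fun n => corrTerm a q.1 q.2 n]
  refine tsum_congr fun n => ?_
  simp only [corrTerm, Equiv.subRight_apply]
  rw [sub_right_comm n q.1 m, sub_right_comm n q.2 m, sub_right_comm (n - m) q.2 q.1,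
    sub_right_comm (n - q.2) q.1 m, sub_right_comm n q.2 m, sub_right_comm (n - m) q.2 q.1]

theorem corr_real_mul (a : ℤ → ℂ) (c : ℝ) (q : ℤ × ℤ) :
    corr (fun n => (c : ℂ) * a n) q = (c : ℂ) ^ 4 * corr a q := by
  rw [corr, corr, ← tsum_mul_left]
  refine tsum_congr fun n => ?_
  simp only [corrTerm, map_mul, Complex.conj_ofReal]
  ring

end Corr

/-- In the expansion of a product of four sums, every mixed term contains an `x` and a `y`. -/
theorem norm_prod_four_add_sub_le {R : ℝ} {x₁ x₂ x₃ x₄ y₁ y₂ y₃ y₄ : ℂ}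
    (hx₁ : ‖x₁‖ ≤ R) (hx₂ : ‖x₂‖ ≤ R) (hx₃ : ‖x₃‖ ≤ R) (hx₄ : ‖x₄‖ ≤ R)
    (hy₁ : ‖y₁‖ ≤ R) (hy₂ : ‖y₂‖ ≤ R) (hy₃ : ‖y₃‖ ≤ R) (hy₄ : ‖y₄‖ ≤ R) :
    ‖(x₁ + y₁) * (x₂ + y₂) * (x₃ + y₃) * (x₄ + y₄) - x₁ * x₂ * x₃ * x₄ - y₁ * y₂ * y₃ * y₄‖ ≤
      4 * R ^ 2 * (‖x₁‖ * ‖y₂‖ + ‖x₂‖ * ‖y₁‖ + ‖x₃‖ * ‖y₄‖ + ‖x₄‖ * ‖y₃‖ + ‖x₁‖ * ‖y₃‖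
        + ‖x₃‖ * ‖y₁‖) := by
  have hR : 0 ≤ R := (norm_nonneg _).trans hx₁
  have e : (x₁ + y₁) * (x₂ + y₂) * (x₃ + y₃) * (x₄ + y₄) - x₁ * x₂ * x₃ * x₄ - y₁ * y₂ * y₃ * y₄ =
      x₁ * y₃ * (x₂ * y₄) + x₃ * y₁ * (x₄ * y₂)
      + (x₁ * y₂ + x₂ * y₁) * ((x₃ + y₃) * (x₄ + y₄))
      + (x₃ * y₄ + x₄ * y₃) * (x₁ * x₂ + y₁ * y₂) := by ring
  have bd : ∀ {z w : ℂ} {r s t : ℝ}, ‖z‖ ≤ r → ‖w‖ ≤ s → s ≤ t → 0 ≤ s → ‖z * w‖ ≤ t * r := by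
    intro z w r s t hz hw hst hs
    rw [norm_mul, mul_comm]
    exact mul_le_mul (hw.trans hst) hz (norm_nonneg _) (hs.trans hst)
  have two : ∀ {z w : ℂ}, ‖z‖ ≤ R → ‖w‖ ≤ R → ‖z * w‖ ≤ R * R := fun hz hw =>
    (norm_mul _ _).trans_le (mul_le_mul hz hw (norm_nonneg _) hR)
  have sm : ∀ {z w : ℂ}, ‖z‖ ≤ R → ‖w‖ ≤ R → ‖z + w‖ ≤ 2 * R := fun hz hw =>
    (norm_add_le _ _).trans (by linarith)
  have hR2 : 0 ≤ R * R := by positivity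
  have t1 : ‖x₁ * y₃ * (x₂ * y₄)‖ ≤ 4 * R ^ 2 * (‖x₁‖ * ‖y₃‖) :=
    bd (norm_mul _ _).le (two hx₂ hy₄) (by nlinarith) hR2
  have t2 : ‖x₃ * y₁ * (x₄ * y₂)‖ ≤ 4 * R ^ 2 * (‖x₃‖ * ‖y₁‖) :=
    bd (norm_mul _ _).le (two hx₄ hy₂) (by nlinarith) hR2
  have t3 : ‖(x₁ * y₂ + x₂ * y₁) * ((x₃ + y₃) * (x₄ + y₄))‖ ≤
      4 * R ^ 2 * (‖x₁‖ * ‖y₂‖ + ‖x₂‖ * ‖y₁‖) := by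
    refine bd (s := 2 * R * (2 * R)) ?_ ?_ (by nlinarith) (by positivity)
    · exact (norm_add_le _ _).trans (by rw [norm_mul, norm_mul])
    · rw [norm_mul]
      exact mul_le_mul (sm hx₃ hy₃) (sm hx₄ hy₄) (norm_nonneg _) (by positivity)
  have t4 : ‖(x₃ * y₄ + x₄ * y₃) * (x₁ * x₂ + y₁ * y₂)‖ ≤
      4 * R ^ 2 * (‖x₃‖ * ‖y₄‖ + ‖x₄‖ * ‖y₃‖) := by
    refine bd (s := R * R + R * R) ?_ ?_ (by nlinarith) (by positivity)
    · exact (norm_add_le _ _).trans (by rw [norm_mul, norm_mul])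
    · exact (norm_add_le _ _).trans (add_le_add (two hx₁ hx₂) (two hy₁ hy₂))
  rw [e]
  have n1 := norm_add_le (x₁ * y₃ * (x₂ * y₄) + x₃ * y₁ * (x₄ * y₂)
      + (x₁ * y₂ + x₂ * y₁) * ((x₃ + y₃) * (x₄ + y₄)))
      ((x₃ * y₄ + x₄ * y₃) * (x₁ * x₂ + y₁ * y₂))
  have n2 := norm_add₃_le (a := x₁ * y₃ * (x₂ * y₄)) (b := x₃ * y₁ * (x₄ * y₂))
      (c := (x₁ * y₂ + x₂ * y₁) * ((x₃ + y₃) * (x₄ + y₄)))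
  linarith

/-- Decoupling of the correlations along a sequence `a + b k` with `b k` bounded and tending to `0`
pointwise. -/
theorem tendsto_corr_decoupling {α : Type*} {F : Filter α} {a : ℤ → ℂ} {b : α → ℤ → ℂ} {C : ℝ}
    (ha : Summable fun i => ‖a i‖ ^ 2) (hb : ∀ k, Summable fun i => ‖b k i‖ ^ 2)
    (haC : mass a ≤ C) (hC : ∀ k, mass (b k) ≤ C) (h0 : ∀ i, Tendsto (fun k => b k i) F (𝓝 0))
    (q : ℤ × ℤ) :
    Tendsto (fun k => corr (fun n => a n + b k n) q - corr a q - corr (b k) q) F (𝓝 0) := by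
  obtain ⟨l, p⟩ := q
  -- the mixed terms are controlled by pairings of a translate of `a` with a translate of `b k`
  have hpair : ∀ s t : ℤ, Tendsto (fun k => ∑' n, ‖a (n - s)‖ * ‖b k (n - t)‖) F (𝓝 0) :=
    fun s t => tendsto_tsum_norm_mul_norm (g := fun k n => b k (n - t)) (C := C)
      (summable_sq_shift ha s)
      (fun k => summable_sq_shift (hb k) t) (fun k => (mass_shift _ _).trans_le (hC k))
      fun i => h0 _
  have hsum : ∀ (s t : ℤ) k, Summable fun n => ‖a (n - s)‖ * ‖b k (n - t)‖ := fun s t k =>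
    summable_norm_mul_norm (summable_sq_shift ha s) (summable_sq_shift (hb k) t)
  have hlim := ((((((hpair 0 l).add (hpair l 0)).add (hpair p (p + l))).add
    (hpair (p + l) p)).add (hpair 0 p)).add (hpair p 0)).const_mul (4 * √C ^ 2)
  simp only [add_zero, mul_zero] at hlim
  refine squeeze_zero_norm (fun k => ?_) hlim
  have hab := summable_sq_add ha (hb k)
  have s1 := (summable_corrTerm hab l p).of_norm
  have s2 := (summable_corrTerm ha l p).of_norm
  have s3 := (summable_corrTerm (hb k) l p).of_norm
  simp only [corr]
  rw [← s1.tsum_sub s2, ← (s1.sub s2).tsum_sub s3]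
  have hs := ((((((hsum 0 l k).hasSum.add (hsum l 0 k).hasSum).add
    (hsum p (p + l) k).hasSum).add (hsum (p + l) p k).hasSum).add
    (hsum 0 p k).hasSum).add (hsum p 0 k).hasSum).mul_left (4 * √C ^ 2)
  refine tsum_of_norm_bounded hs fun n => ?_
  have hA : ∀ n, ‖a n‖ ≤ √C := fun n => Real.le_sqrt_of_sq_le ((sq_norm_le_mass ha n).trans haC)
  have hB : ∀ n, ‖b k n‖ ≤ √C := fun n =>
    Real.le_sqrt_of_sq_le ((sq_norm_le_mass (hb k) n).trans (hC k))
  have h := norm_prod_four_add_sub_le (R := √C) (x₁ := a n) (x₂ := conj (a (n - l)))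
    (x₃ := conj (a (n - p))) (x₄ := a (n - p - l)) (y₁ := b k n) (y₂ := conj (b k (n - l)))
    (y₃ := conj (b k (n - p))) (y₄ := b k (n - p - l)) (hA _) (by simpa using hA _)
    (by simpa using hA _) (hA _) (hB _) (by simpa using hB _) (by simpa using hB _) (hB _)
  simp only [RCLike.norm_conj] at h
  simpa only [corrTerm, map_add, sub_zero, ← sub_sub] using h

/-! ### Quartic functionals and the existence of maximizers -/

/-- The quartic functional `Re ∑ κ(l, p) corr a (l, p)` with coefficients `κ`. -/
noncomputable def quartic (κ : ℤ × ℤ → ℂ) (a : ℤ → ℂ) : ℝ := (∑' q, κ q * corr a q).re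

section Quartic

variable {κ : ℤ × ℤ → ℂ} {a : ℤ → ℂ}

theorem summable_mul_corr (hκ : Summable fun q => ‖κ q‖ ^ 2) (ha : Summable fun n => ‖a n‖ ^ 2) :
    Summable fun q => ‖κ q * corr a q‖ := by
  simpa only [norm_mul] using summable_norm_mul_norm hκ (summable_sq_corr ha)

theorem abs_quartic_le (hκ : Summable fun q => ‖κ q‖ ^ 2) (ha : Summable fun n => ‖a n‖ ^ 2) :
    |quartic κ a| ≤ √(mass κ) * mass a ^ 2 := by
  refine (Complex.abs_re_le_norm _).trans ((norm_tsum_le_tsum_norm (summable_mul_corr hκ ha)).trans ?_)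
  simp only [norm_mul]
  refine (tsum_norm_mul_norm_le_sqrt hκ (summable_sq_corr ha)).trans ?_
  rw [Real.sqrt_mul (mass_nonneg κ)]
  refine mul_le_mul_of_nonneg_left ?_ (Real.sqrt_nonneg _)
  refine Real.sqrt_le_iff.2 ⟨by positivity, (mass_corr_le ha).trans (le_of_eq (by ring))⟩

theorem quartic_shift (κ : ℤ × ℤ → ℂ) (a : ℤ → ℂ) (m : ℤ) :
    quartic κ (fun n => a (n - m)) = quartic κ a := by
  simp only [quartic, corr_shift]

theorem quartic_real_mul (κ : ℤ × ℤ → ℂ) (a : ℤ → ℂ) (c : ℝ) :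
    quartic κ (fun n => (c : ℂ) * a n) = c ^ 4 * quartic κ a := by
  simp only [quartic, corr_real_mul]
  rw [← Complex.re_ofReal_mul, ← tsum_mul_left]
  congr 1
  refine tsum_congr fun q => ?_
  push_cast
  ring

theorem mass_real_mul (a : ℤ → ℂ) (c : ℝ) : mass (fun n => (c : ℂ) * a n) = c ^ 2 * mass a := by
  rw [mass, mass, ← tsum_mul_left]
  refine tsum_congr fun n => ?_
  rw [norm_mul, mul_pow, Complex.norm_real, Real.norm_eq_abs, sq_abs]

theorem summable_sq_real_mul (ha : Summable fun n => ‖a n‖ ^ 2) (c : ℝ) :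
    Summable fun n => ‖(c : ℂ) * a n‖ ^ 2 := by
  simp only [norm_mul, mul_pow]
  exact ha.mul_left _

/-- A bound for a quartic functional on the unit sphere gives one everywhere, by homogeneity. -/
theorem quartic_le_mul_sq_mass {S : ℝ}
    (hS : ∀ b : ℤ → ℂ, (Summable fun n => ‖b n‖ ^ 2) → mass b = 1 → quartic κ b ≤ S)
    (hκ : Summable fun q => ‖κ q‖ ^ 2) (ha : Summable fun n => ‖a n‖ ^ 2) :
    quartic κ a ≤ S * mass a ^ 2 := by
  rcases (mass_nonneg a).eq_or_lt with h | h
  · have h1 := abs_quartic_le hκ ha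
    rw [← h] at h1 ⊢
    simpa using (le_abs_self _).trans h1
  · set c : ℝ := (√(mass a))⁻¹ with hc
    have hc2 : c ^ 2 = (mass a)⁻¹ := by rw [hc, inv_pow, Real.sq_sqrt h.le]
    have h1 := hS _ (summable_sq_real_mul ha c) (by
      rw [mass_real_mul, hc2, inv_mul_cancel₀ h.ne'])
    rw [quartic_real_mul, show c ^ 4 = (c ^ 2) ^ 2 by ring, hc2, inv_pow] at h1
    rwa [inv_mul_le_iff₀ (by positivity), mul_comm] at h1

/-- If `g k` is bounded in `ℓ²` and tends to `0` pointwise, then its pairing with `κ` tends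
to `0`. -/
theorem tendsto_re_tsum_mul {α : Type*} {F : Filter α} {g : α → ℤ × ℤ → ℂ} {C : ℝ}
    (hκ : Summable fun q => ‖κ q‖ ^ 2) (hg : ∀ k, Summable fun q => ‖g k q‖ ^ 2)
    (hC : ∀ k, mass (g k) ≤ C) (h0 : ∀ q, Tendsto (fun k => g k q) F (𝓝 0)) :
    Tendsto (fun k => (∑' q, κ q * g k q).re) F (𝓝 0) := by
  refine squeeze_zero_norm (fun k => ?_) (tendsto_tsum_norm_mul_norm hκ hg hC h0)
  refine (Complex.abs_re_le_norm _).trans ?_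
  have := summable_norm_mul_norm hκ (hg k)
  simp only [← norm_mul] at this ⊢
  exact norm_tsum_le_tsum_norm this

/-- A sequence of unit mass that vanishes uniformly makes the quartic functional tend to `0`. -/
theorem tendsto_quartic_of_vanishing {α : Type*} {F : Filter α} {b : α → ℤ → ℂ} {R : α → ℝ}
    (hκ : Summable fun q => ‖κ q‖ ^ 2) (hb : ∀ k, Summable fun n => ‖b k n‖ ^ 2)
    (hm : ∀ k, mass (b k) = 1) (hR : ∀ k n, ‖b k n‖ ≤ R k) (h0 : Tendsto R F (𝓝 0)) :
    Tendsto (fun k => quartic κ (b k)) F (𝓝 0) := by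
  refine tendsto_re_tsum_mul (C := 1) hκ (fun k => summable_sq_corr (hb k)) (fun k => ?_)
    fun q => ?_
  · simpa [hm k] using mass_corr_le (hb k)
  · refine squeeze_zero_norm (fun k => ?_) (a := fun k => R k ^ 2) (by simpa using h0.pow 2)
    simpa [hm k] using norm_corr_le_of_bound (hb k) (hR k) q

/-- Decoupling of the quartic functional along `a + b k` with `b k` bounded and tending to `0`
pointwise. -/
theorem tendsto_quartic_decoupling {α : Type*} {F : Filter α} {b : α → ℤ → ℂ} {C : ℝ}
    (hκ : Summable fun q => ‖κ q‖ ^ 2) (ha : Summable fun n => ‖a n‖ ^ 2)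
    (hb : ∀ k, Summable fun n => ‖b k n‖ ^ 2) (haC : mass a ≤ C) (hC : ∀ k, mass (b k) ≤ C)
    (h0 : ∀ n, Tendsto (fun k => b k n) F (𝓝 0)) :
    Tendsto (fun k => quartic κ (fun n => a n + b k n) - quartic κ a - quartic κ (b k))
      F (𝓝 0) := by
  have hab := fun k => summable_sq_add ha (hb k)
  have sab := fun k => summable_sq_corr (hab k)
  have sa := summable_sq_corr ha
  have sb := fun k => summable_sq_corr (hb k)
  have h := tendsto_re_tsum_mul hκ (C := 2 * (2 * ((4 * C) ^ 4 + C ^ 4) + C ^ 4))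
    (fun k => summable_sq_sub (summable_sq_sub (sab k) sa) (sb k)) (fun k => ?_)
    (tendsto_corr_decoupling ha hb haC hC h0)
  · refine h.congr fun k => ?_
    have m1 := (summable_mul_corr hκ (hab k)).of_norm
    have m2 := (summable_mul_corr hκ ha).of_norm
    have m3 := (summable_mul_corr hκ (hb k)).of_norm
    simp only [quartic, mul_sub]
    rw [(m1.sub m2).tsum_sub m3, m1.tsum_sub m2, Complex.sub_re, Complex.sub_re]
  · have h1 := mass_sub_le (summable_sq_sub (sab k) sa) (sb k)
    have h2 := mass_sub_le (sab k) sa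
    have h3 := mass_corr_le (hab k)
    have h4 := pow_le_pow_left₀ (mass_nonneg _) haC 4
    have h5 := pow_le_pow_left₀ (mass_nonneg _) (hC k) 4
    have h6 : mass (fun n => a n + b k n) ≤ 4 * C := by
      have := mass_add_le ha (hb k)
      linarith [hC k]
    have h7 := pow_le_pow_left₀ (mass_nonneg _) h6 4
    have h8 := mass_corr_le ha
    have h9 := mass_corr_le (hb k)
    linarith

/-- From a sequence bounded by `1` in every entry one extracts a pointwise convergent
subsequence. -/
theorem exists_subseq_tendsto_pointwise {b : ℕ → ℤ → ℂ} (hb : ∀ k n, ‖b k n‖ ≤ 1) :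
    ∃ (a : ℤ → ℂ) (φ : ℕ → ℕ), StrictMono φ ∧
      ∀ n, Tendsto (fun k => b (φ k) n) atTop (𝓝 (a n)) := by
  have hK : IsCompact (Set.univ.pi fun _ : ℤ => Metric.closedBall (0 : ℂ) 1) :=
    isCompact_univ_pi fun _ => isCompact_closedBall _ _
  obtain ⟨a, -, φ, hφ, h⟩ := hK.tendsto_subseq (x := b) fun k => by
    simpa [Set.mem_univ_pi] using hb k
  exact ⟨a, φ, hφ, fun n => (tendsto_pi_nhds.1 h) n⟩

theorem summable_and_mass_le_of_tendsto {b : ℕ → ℤ → ℂ} {C : ℝ}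
    (hb : ∀ k, Summable fun n => ‖b k n‖ ^ 2) (hC : ∀ k, mass (b k) ≤ C)
    (h : ∀ n, Tendsto (fun k => b k n) atTop (𝓝 (a n))) :
    (Summable fun n => ‖a n‖ ^ 2) ∧ mass a ≤ C := by
  have hfin : ∀ s : Finset ℤ, ∑ n ∈ s, ‖a n‖ ^ 2 ≤ C := fun s => by
    refine le_of_tendsto (tendsto_finsetSum s fun n _ => (h n).norm.pow 2)
      (Eventually.of_forall fun k => ?_)
    exact ((hb k).sum_le_tsum s fun _ _ => by positivity).trans (hC k)
  have hs := summable_of_sum_le (f := fun n => ‖a n‖ ^ 2) (fun n => by positivity) hfin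
  exact ⟨hs, hs.tsum_le_of_sum_le hfin⟩

theorem exists_forall_norm_le (ha : Summable fun n => ‖a n‖ ^ 2) :
    ∃ m : ℤ, ∀ n, ‖a n‖ ≤ ‖a m‖ := by
  by_cases h : ∀ n, ‖a n‖ ^ 2 ≤ 0
  · refine ⟨0, fun n => ?_⟩
    exact ((sq_eq_zero_iff.1 ((h n).antisymm (by positivity))).trans_le (norm_nonneg _))
  · push Not at h
    obtain ⟨n₀, h₀⟩ := h
    obtain ⟨m, hm⟩ := (continuous_of_discreteTopology (f := fun n : ℤ => ‖a n‖ ^ 2)).exists_forall_ge'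
      n₀ (by
        rw [Filter.cocompact_eq_cofinite]
        exact (ha.tendsto_cofinite_zero.eventually (gt_mem_nhds h₀)).mono fun _ h => h.le)
    exact ⟨m, fun n => (pow_le_pow_iff_left₀ (norm_nonneg _) (norm_nonneg _) two_ne_zero).1 (hm n)⟩

/-- A quartic functional with square-summable coefficients that is positive somewhere attains its
supremum over the sequences of unit mass. A maximizing sequence, translated so that its largest
entry sits at the origin, has a nonzero pointwise limit `a`; by decoupling, splitting the mass `1`
as `m + (1 - m)` would cost `S ≤ S (m² + (1 - m)²)`, so all the mass stays in `a`. -/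
theorem exists_quartic_maximizer (hκ : Summable fun q => ‖κ q‖ ^ 2)
    {w : ℤ → ℂ} (hw : Summable fun n => ‖w n‖ ^ 2) (hpos : 0 < quartic κ w) :
    ∃ a : ℤ → ℂ, (Summable fun n => ‖a n‖ ^ 2) ∧ mass a = 1 ∧
      ∀ b : ℤ → ℂ, (Summable fun n => ‖b n‖ ^ 2) → mass b = 1 → quartic κ b ≤ quartic κ a := by
  set V : Set ℝ := {x | ∃ b : ℤ → ℂ, (Summable fun n => ‖b n‖ ^ 2) ∧ mass b = 1 ∧
    quartic κ b = x} with hV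
  have hbdd : BddAbove V := by
    refine ⟨√(mass κ), ?_⟩
    rintro x ⟨b, hb, hm, rfl⟩
    simpa [hm] using (le_abs_self _).trans (abs_quartic_le hκ hb)
  have hS : ∀ b : ℤ → ℂ, (Summable fun n => ‖b n‖ ^ 2) → mass b = 1 → quartic κ b ≤ sSup V :=
    fun b hb hm => le_csSup hbdd ⟨b, hb, hm, rfl⟩
  have hSpos : 0 < sSup V := by
    have h1 := hpos.trans_le (quartic_le_mul_sq_mass hS hκ hw)
    by_contra h2
    nlinarith [sq_nonneg (mass w)]
  have hne : V.Nonempty := by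
    by_contra h
    rw [Set.not_nonempty_iff_eq_empty.1 h, Real.sSup_empty] at hSpos
    exact hSpos.false
  obtain ⟨x, -, hx, hxV⟩ := exists_seq_tendsto_sSup hne hbdd
  choose c hc hcm hcx using hxV
  choose m hm using fun k => exists_forall_norm_le (hc k)
  -- the translated maximizing sequence, whose largest entry is at `0`
  have hs : ∀ k, Summable fun n => ‖c k (n - -m k)‖ ^ 2 := fun k => summable_sq_shift (hc k) _
  have hsm : ∀ k, mass (fun n => c k (n - -m k)) = 1 := fun k => (mass_shift _ _).trans (hcm k)
  have hmax : ∀ k n, ‖c k (n - -m k)‖ ≤ ‖c k (0 - -m k)‖ := fun k n => by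
    simpa using hm k _
  obtain ⟨a, φ, hφ, hlim⟩ := exists_subseq_tendsto_pointwise
    (b := fun k n => c k (n - -m k)) fun k n => by
      have := sq_norm_le_mass (hs k) n
      rw [hsm k] at this
      exact (sq_le_one_iff₀ (norm_nonneg _)).1 this
  set u : ℕ → ℤ → ℂ := fun k n => c (φ k) (n - -m (φ k)) with hu
  have us : ∀ k, Summable fun n => ‖u k n‖ ^ 2 := fun k => hs (φ k)
  have um : ∀ k, mass (u k) = 1 := fun k => hsm (φ k)
  have uq : Tendsto (fun k => quartic κ (u k)) atTop (𝓝 (sSup V)) := by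
    refine (hx.comp hφ.tendsto_atTop).congr fun k => ?_
    rw [Function.comp, ← hcx, hu, quartic_shift]
  obtain ⟨ha, ham⟩ := summable_and_mass_le_of_tendsto us (fun k => (um k).le) hlim
  have ha0 : a 0 ≠ 0 := fun h => by
    have h1 := (hlim 0).norm
    rw [h, norm_zero] at h1
    have h2 := tendsto_quartic_of_vanishing hκ us um (fun k n => hmax (φ k) n) h1
    exact hSpos.ne' (tendsto_nhds_unique uq h2)
  have hapos : 0 < mass a :=
    (by positivity : 0 < ‖a 0‖ ^ 2).trans_le (sq_norm_le_mass ha 0)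
  -- the remainder after removing the pointwise limit
  set b : ℕ → ℤ → ℂ := fun k n => u k n - a n with hb
  have bs : ∀ k, Summable fun n => ‖b k n‖ ^ 2 := fun k => summable_sq_sub (us k) ha
  have bm : ∀ k, mass (b k) ≤ 4 := fun k => by
    have := mass_sub_le (us k) ha
    rw [um k] at this
    linarith
  have b0 : ∀ n, Tendsto (fun k => b k n) atTop (𝓝 0) := fun n => by
    simpa only [hb, sub_self] using (hlim n).sub_const (a n)
  have hab : ∀ k, (fun n => a n + b k n) = u k := fun k => funext fun n => by simp [hb]
  have d1 := tendsto_mass_decoupling ha bs bm b0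
  have d2 := tendsto_quartic_decoupling hκ ha bs (by linarith) bm b0
  simp only [hab, um] at d1 d2
  have d3 : Tendsto (fun k => mass (b k)) atTop (𝓝 (1 - mass a)) := by
    simpa using (tendsto_const_nhds (x := 1 - mass a)).sub d1
  have d4 : Tendsto (fun k => quartic κ (b k)) atTop (𝓝 (sSup V - quartic κ a)) := by
    simpa using (uq.sub_const (quartic κ a)).sub d2
  have h1 : sSup V - quartic κ a ≤ sSup V * (1 - mass a) ^ 2 :=
    le_of_tendsto_of_tendsto' d4 ((d3.pow 2).const_mul _) fun k =>
      quartic_le_mul_sq_mass hS hκ (bs k)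
  have h2 := quartic_le_mul_sq_mass hS hκ ha
  have h3 : mass a = 1 := by
    by_contra h
    have h4 : 0 < mass a * (1 - mass a) := mul_pos hapos (sub_pos.2 (lt_of_le_of_ne ham h))
    nlinarith [mul_pos hSpos h4]
  refine ⟨a, ha, h3, fun v hv hvm => (hS v hv hvm).trans ?_⟩
  rw [h3] at h1
  linarith

end Quartic

/-! ### Parseval's identity for integrable functions on the circle -/

section Circle

variable {T : ℝ} [hT : Fact (0 < T)]

open AddCircle

theorem integral_continuousMap_mul_eq_zero {f : AddCircle T → ℂ} (hf : Integrable f haarAddCircle)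
    (h : ∀ n, fourierCoeff f n = 0) (g : C(AddCircle T, ℂ)) :
    ∫ x, g x * f x ∂haarAddCircle = 0 := by
  have hint : ∀ g : C(AddCircle T, ℂ), Integrable (fun x => g x * f x) haarAddCircle := fun g =>
    hf.bdd_mul (c := ‖g‖) (map_continuous g).aestronglyMeasurable
      (ae_of_all _ fun x => g.norm_coe_le_norm x)
  let L : C(AddCircle T, ℂ) →ₗ[ℂ] ℂ :=
    { toFun := fun g => ∫ x, g x * f x ∂haarAddCircle
      map_add' := fun g₁ g₂ => by
        simp only [ContinuousMap.add_apply, add_mul]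
        exact integral_add (hint g₁) (hint g₂)
      map_smul' := fun c g => by
        simp only [ContinuousMap.smul_apply, smul_eq_mul, mul_assoc, RingHom.id_apply]
        exact integral_const_mul _ _ }
  let L' : C(AddCircle T, ℂ) →L[ℂ] ℂ := L.mkContinuous (∫ x, ‖f x‖ ∂haarAddCircle) fun g => by
    refine (norm_integral_le_integral_norm _).trans ?_
    rw [mul_comm, ← integral_const_mul]
    refine integral_mono (hint g).norm (hf.norm.const_mul _) fun x => ?_
    simp only [norm_mul]
    exact mul_le_mul_of_nonneg_right (g.norm_coe_le_norm x) (norm_nonneg _)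
  have hker : (⊤ : Submodule ℂ C(AddCircle T, ℂ)) ≤ L'.ker := by
    rw [← span_fourier_closure_eq_top]
    refine Submodule.topologicalClosure_minimal _ (Submodule.span_le.2 ?_) L'.isClosed_ker
    rintro _ ⟨n, rfl⟩
    have := h (-n)
    rw [fourierCoeff, neg_neg] at this
    exact this
  exact hker (Submodule.mem_top (x := g))

/-- Fourier coefficients determine an integrable function almost everywhere: trigonometric
polynomials are uniformly dense in the continuous functions, and those approximate indicators of
closed sets. -/
theorem ae_eq_zero_of_fourierCoeff_eq_zero {f : AddCircle T → ℂ}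
    (hf : Integrable f haarAddCircle) (h : ∀ n, fourierCoeff f n = 0) :
    f =ᵐ[haarAddCircle] 0 := by
  refine ae_eq_zero_of_forall_setIntegral_isClosed_eq_zero hf fun K hK => ?_
  have hg : ∀ n, ∫ x, ((hK.apprSeq n x : ℝ) : ℂ) * f x ∂haarAddCircle = 0 := fun n =>
    integral_continuousMap_mul_eq_zero hf h ⟨fun x => ((hK.apprSeq n x : ℝ) : ℂ), by fun_prop⟩
  have hlim : Tendsto (fun n => ∫ x, ((hK.apprSeq n x : ℝ) : ℂ) * f x ∂haarAddCircle) atTop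
      (𝓝 (∫ x, K.indicator f x ∂haarAddCircle)) := by
    refine tendsto_integral_of_dominated_convergence (fun x => ‖f x‖) (fun n => ?_) hf.norm
      (fun n => ae_of_all _ fun x => ?_) (ae_of_all _ fun x => ?_)
    · exact (Continuous.aestronglyMeasurable (by fun_prop)).mul hf.aestronglyMeasurable
    · rw [norm_mul]
      refine mul_le_of_le_one_left (norm_nonneg _) ?_
      rw [Complex.norm_real, NNReal.norm_eq]
      exact_mod_cast HasOuterApproxClosed.apprSeq_apply_le_one hK n x
    · have h1 := tendsto_pi_nhds.1 (HasOuterApproxClosed.tendsto_apprSeq hK) x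
      have h2 : Tendsto (fun n => ((hK.apprSeq n x : ℝ) : ℂ)) atTop
          (𝓝 (((K.indicator (fun _ => (1 : NNReal)) x : NNReal) : ℝ) : ℂ)) :=
        (Complex.continuous_ofReal.tendsto _).comp ((NNReal.continuous_coe.tendsto _).comp h1)
      have h3 := h2.mul_const (f x)
      by_cases hx : x ∈ K <;> simpa [hx] using h3
  rw [integral_indicator hK.measurableSet] at hlim
  simp only [hg] at hlim
  exact (tendsto_nhds_unique tendsto_const_nhds hlim).symm

theorem enorm_sq_eq_ofReal (z : ℂ) : ‖z‖ₑ ^ 2 = ENNReal.ofReal (‖z‖ ^ 2) := by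
  rw [ENNReal.ofReal_pow (norm_nonneg _), ofReal_norm]

/-- Parseval's identity in `[0, ∞]` for a function that is merely integrable. -/
theorem lintegral_enorm_sq_eq_tsum {f : AddCircle T → ℂ} (hf : Integrable f haarAddCircle) :
    ∫⁻ x, ‖f x‖ₑ ^ 2 ∂haarAddCircle = ∑' n, ‖fourierCoeff f n‖ₑ ^ 2 := by
  by_cases h2 : MemLp f 2 haarAddCircle
  · have hc : fourierCoeff (h2.toLp f) = fourierCoeff f := fourierCoeff_congr_ae h2.coeFn_toLp
    have hs := hasSum_sq_fourierCoeff (h2.toLp f)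
    rw [hc] at hs
    have e1 : ∫ x, ‖h2.toLp f x‖ ^ 2 ∂haarAddCircle = ∫ x, ‖f x‖ ^ 2 ∂haarAddCircle :=
      integral_congr_ae (h2.coeFn_toLp.mono fun x hx => by simp only [hx])
    rw [e1] at hs
    simp_rw [enorm_sq_eq_ofReal]
    rw [← ofReal_integral_eq_lintegral_ofReal h2.integrable_norm_pow'
      (ae_of_all _ fun x => by positivity), ← hs.tsum_eq,
      ENNReal.ofReal_tsum_of_nonneg (fun n => by positivity) hs.summable]
  · have hl : ∫⁻ x, ‖f x‖ₑ ^ 2 ∂haarAddCircle = ⊤ := by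
      by_contra h
      refine h2 ⟨hf.aestronglyMeasurable, ?_⟩
      rw [eLpNorm_lt_top_iff_lintegral_rpow_enorm_lt_top two_ne_zero ENNReal.ofNat_ne_top]
      simpa using lt_top_iff_ne_top.2 h
    rw [hl]
    by_contra h
    -- a square-summable sequence of coefficients is that of an `L²` function, which must be `f`
    have hs : Summable fun n => ‖fourierCoeff f n‖ ^ 2 := by
      simp_rw [enorm_sq_eq_ofReal] at h
      have := ENNReal.summable_toReal (Ne.symm h)
      simpa [ENNReal.toReal_ofReal, sq_nonneg] using this
    let a : lp (fun _ : ℤ => ℂ) 2 := ⟨fourierCoeff f, by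
      refine memℓp_gen ?_
      simpa using hs⟩
    let g := (fourierBasis (T := T)).repr.symm a
    have hg : ∀ n, fourierCoeff g n = fourierCoeff f n := fun n => by
      rw [← fourierBasis_repr, LinearIsometryEquiv.apply_symm_apply]
    have hgi : Integrable g haarAddCircle := (Lp.memLp g).integrable one_le_two
    have h0 : f - (g : AddCircle T → ℂ) =ᵐ[haarAddCircle] 0 := by
      refine ae_eq_zero_of_fourierCoeff_eq_zero (hf.sub hgi) fun n => ?_
      have e : f - (g : AddCircle T → ℂ) = f + (-1 : ℂ) • (g : AddCircle T → ℂ) := by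
        rw [neg_one_smul, sub_eq_add_neg]
      rw [e, fourierCoeff.add hf (hgi.smul _), Pi.add_apply, fourierCoeff.const_smul, hg]
      simp
    exact h2 ((Lp.memLp g).ae_eq (h0.mono fun x hx => (sub_eq_zero.1 hx).symm))

/-- The Fourier coefficients of `|f|²` are the autocorrelations of those of `f`. -/
theorem hasSum_fourierCoeff_mul_conj {f : AddCircle T → ℂ} (hf : MemLp f 2 haarAddCircle) (l : ℤ) :
    HasSum (fun n => fourierCoeff f n * conj (fourierCoeff f (n - l)))
      (fourierCoeff (fun x => f x * conj (f x)) l) := by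
  have hg : MemLp (fun x => fourier l x * f x) 2 haarAddCircle := by
    refine hf.of_le ((map_continuous (fourier l)).aestronglyMeasurable.mul hf.1)
      (ae_of_all _ fun x => ?_)
    rw [norm_mul, fourier_apply, Circle.norm_coe, one_mul]
  have h := fourierBasis.hasSum_inner_mul_inner (hg.toLp _) (hf.toLp f)
  have e : inner ℂ (hg.toLp _) (hf.toLp f) = fourierCoeff (fun x => f x * conj (f x)) l := by
    rw [MeasureTheory.L2.inner_def, fourierCoeff]
    refine integral_congr_ae ?_
    filter_upwards [hg.coeFn_toLp, hf.coeFn_toLp] with x h1 h2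
    rw [h1, h2, RCLike.inner_apply', map_mul, fourier_neg, smul_eq_mul]
    ring
  rw [e] at h
  refine h.congr_fun fun n => ?_
  have c1 : inner ℂ (fourierBasis n) (hf.toLp f) = fourierCoeff f n := by
    rw [← fourierBasis.repr_apply_apply, fourierBasis_repr,
      fourierCoeff_congr_ae hf.coeFn_toLp]
  have c2 : inner ℂ (fourierBasis n) (hg.toLp _) = fourierCoeff f (n - l) := by
    rw [← fourierBasis.repr_apply_apply, fourierBasis_repr,
      fourierCoeff_congr_ae hg.coeFn_toLp, fourierCoeff, fourierCoeff]
    refine integral_congr_ae (ae_of_all _ fun x => ?_)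
    simp only [smul_eq_mul]
    rw [← mul_assoc, ← fourier_add, neg_sub, neg_add_eq_sub]
  rw [c1, ← inner_conj_symm, c2, mul_comm]

theorem lintegral_enorm_pow_four_eq_tsum {f : AddCircle T → ℂ} (hf : MemLp f 2 haarAddCircle) :
    ∫⁻ x, ‖f x‖ₑ ^ 4 ∂haarAddCircle =
      ∑' l, ‖∑' n, fourierCoeff f n * conj (fourierCoeff f (n - l))‖ₑ ^ 2 := by
  have hi : Integrable (fun x => f x * conj (f x)) haarAddCircle :=
    hf.integrable_mul (q := 2) hf.star
  have h := lintegral_enorm_sq_eq_tsum hi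
  simp_rw [(hasSum_fourierCoeff_mul_conj hf _).tsum_eq]
  rw [← h]
  refine lintegral_congr fun x => ?_
  rw [enorm_mul, RCLike.enorm_conj]
  ring

end Circle

/-! ### The Fourier expansion of the Strichartz integral -/

/-- The summand of `densityCoeff`. -/
noncomputable def densityTerm (a : ℤ → ℂ) (l : ℤ) (t : ℝ) (n : ℤ) : ℂ :=
  a n * conj (a (n - l)) *
    Complex.exp (((-(((n : ℝ) ^ 2 - ((n - l : ℤ) : ℝ) ^ 2) * t) : ℝ) : ℂ) * Complex.I)

/-- The `l`-th Fourier coefficient of `|T_t u|²`, in terms of the Fourier coefficients `a` of `u`. -/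
noncomputable def densityCoeff (a : ℤ → ℂ) (l : ℤ) (t : ℝ) : ℂ :=
  ∑' n, densityTerm a l t n

/-- The oscillatory integral in the definition of `D_B`. -/
noncomputable def osc (B : ℝ) (l p : ℤ) : ℂ :=
  ∫ t in (0 : ℝ)..B, Complex.exp (-(2 * Complex.I * l * p * t))

/-- The coefficients of `A_B` as a quartic functional. The value `-1` at the origin accounts for
the term `-∑ |û(n)|⁴`. -/
noncomputable def kernelCoeff (B : ℝ) (q : ℤ × ℤ) : ℂ :=
  if q = 0 then -1 else if q.1 = 0 ∨ q.2 = 0 then 0 else osc B q.1 q.2 / B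

theorem osc_zero_left (B : ℝ) (p : ℤ) : osc B 0 p = B := by simp [osc]

theorem osc_zero_right (B : ℝ) (l : ℤ) : osc B l 0 = B := by simp [osc]

theorem norm_osc_le (B : ℝ) {l p : ℤ} (hl : l ≠ 0) (hp : p ≠ 0) :
    ‖osc B l p‖ ≤ |(l : ℝ)|⁻¹ * |(p : ℝ)|⁻¹ := by
  have hl' : (l : ℂ) ≠ 0 := by exact_mod_cast hl
  have hp' : (p : ℂ) ≠ 0 := by exact_mod_cast hp
  have hc : -(2 * Complex.I * l * p) ≠ 0 := by simp [hl', hp']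
  have e : ∀ s : ℝ, ‖Complex.exp (-(2 * Complex.I * l * p) * s)‖ = 1 := fun s => by
    have : -(2 * Complex.I * l * p) * s = ((-(2 * l * p * s) : ℝ) : ℂ) * Complex.I := by
      push_cast; ring
    rw [this, Complex.norm_exp_ofReal_mul_I]
  have hl0 : 0 < |(l : ℝ)| := by simpa using hl
  have hp0 : 0 < |(p : ℝ)| := by simpa using hp
  have h1 : ∀ t : ℝ, -(2 * Complex.I * l * p * t) = -(2 * Complex.I * l * p) * t :=
    fun t => by ring
  simp_rw [osc, h1]
  rw [integral_exp_mul_complex hc, norm_div]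
  have hn : ‖-(2 * Complex.I * l * p)‖ = 2 * (|(l : ℝ)| * |(p : ℝ)|) := by
    simp [mul_assoc]
  have h2 := norm_sub_le (Complex.exp (-(2 * Complex.I * l * p) * B))
    (Complex.exp (-(2 * Complex.I * l * p) * (0 : ℝ)))
  rw [e, e] at h2
  rw [hn, ← mul_inv, div_le_iff₀ (by positivity)]
  refine h2.trans (le_of_eq ?_)
  field_simp
  norm_num

theorem summable_sq_kernelCoeff (B : ℝ) : Summable fun q => ‖kernelCoeff B q‖ ^ 2 := by
  have hl : Summable fun l : ℤ => ((l : ℝ) ^ 2)⁻¹ := by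
    simpa using Real.summable_one_div_int_pow.2 one_lt_two
  have h1 := (hl.mul_of_nonneg hl (fun l => by positivity) fun l => by positivity).mul_left
    (|B|⁻¹ ^ 2)
  have h2 : Summable fun q : ℤ × ℤ => if q = 0 then (1 : ℝ) else 0 :=
    (hasSum_ite_eq (0 : ℤ × ℤ) (1 : ℝ)).summable
  refine Summable.of_nonneg_of_le (fun q => by positivity) (fun q => ?_) (h2.add h1)
  obtain ⟨l, p⟩ := q
  have h0 : 0 ≤ |B|⁻¹ ^ 2 * (((l : ℝ) ^ 2)⁻¹ * ((p : ℝ) ^ 2)⁻¹) := by positivity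
  simp only [kernelCoeff]
  split_ifs with hq hlp
  · simpa using h0
  · simpa using h0
  · push Not at hlp
    rw [norm_div, Complex.norm_real, Real.norm_eq_abs, div_eq_mul_inv, mul_pow, zero_add, mul_comm]
    refine mul_le_mul_of_nonneg_left ?_ (by positivity)
    refine (pow_le_pow_left₀ (norm_nonneg _) (norm_osc_le B hlp.1 hlp.2) 2).trans (le_of_eq ?_)
    rw [mul_pow, inv_pow, inv_pow, sq_abs, sq_abs]

theorem osc_eq_kernelCoeff {B : ℝ} (hB : B ≠ 0) (l p : ℤ) :
    osc B l p = B * (kernelCoeff B (l, p) + (if l = 0 then 1 else 0) + if p = 0 then 1 else 0) := by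
  have hB' : (B : ℂ) ≠ 0 := by exact_mod_cast hB
  by_cases hl : l = 0
  · subst hl
    rw [osc_zero_left]
    by_cases hp : p = 0 <;> simp [kernelCoeff, hp]
  · by_cases hp : p = 0
    · subst hp
      simp [osc_zero_right, kernelCoeff, hl]
    · simp [kernelCoeff, hl, hp]
      field_simp

section Density

variable {a : ℤ → ℂ}

theorem norm_exp_mul (z : ℂ) (r : ℝ) : ‖z * Complex.exp ((r : ℂ) * Complex.I)‖ = ‖z‖ := by
  rw [norm_mul, Complex.norm_exp_ofReal_mul_I, mul_one]

theorem summable_norm_mul_conj_shift (ha : Summable fun n => ‖a n‖ ^ 2) (l : ℤ) :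
    Summable fun n => ‖a n * conj (a (n - l))‖ := by
  simpa using summable_norm_mul_norm ha (summable_sq_shift ha l)

theorem continuous_densityCoeff (ha : Summable fun n => ‖a n‖ ^ 2) (l : ℤ) :
    Continuous (densityCoeff a l) := by
  refine continuous_tsum (fun n => by unfold densityTerm; fun_prop) (summable_norm_mul_conj_shift ha l)
    fun n t => (norm_exp_mul _ _).le

/-- The change of variables `(n, p) ↦ (n, n - p)` of `ℤ²`. -/
def subEquiv : ℤ × ℤ ≃ ℤ × ℤ where
  toFun r := (r.1, r.1 - r.2)
  invFun r := (r.1, r.1 - r.2)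
  left_inv r := by ext <;> simp
  right_inv r := by ext <;> simp

theorem norm_corrTerm_eq_mul (a : ℤ → ℂ) (l p n : ℤ) :
    ‖corrTerm a l p n‖ = ‖a n * conj (a (n - l))‖ * ‖a (n - p) * conj (a (n - p - l))‖ := by
  simp only [corrTerm, norm_mul, RCLike.norm_conj]; ring

theorem summable_corrTerm_prod (ha : Summable fun n => ‖a n‖ ^ 2) (l : ℤ) :
    Summable fun r : ℤ × ℤ => ‖corrTerm a l r.2 r.1‖ := by
  have h := summable_norm_mul_conj_shift ha l
  have h2 := h.mul_of_nonneg h (fun _ => norm_nonneg _) (fun _ => norm_nonneg _)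
  refine (subEquiv.summable_iff.2 h2).congr fun r => ?_
  simp only [Function.comp, subEquiv, Equiv.coe_fn_mk, norm_corrTerm_eq_mul]

theorem hasSum_mul_prod {ι : Type*} {f g : ι → ℂ} {x y : ℂ} (hf : HasSum f x) (hg : HasSum g y)
    (hfs : Summable fun n => ‖f n‖) (hgs : Summable fun n => ‖g n‖) :
    HasSum (fun r : ι × ι => f r.1 * g r.2) (x * y) :=
  hf.mul hg (summable_mul_of_summable_norm hfs hgs)

theorem densityTerm_mul_conj (a : ℤ → ℂ) (l : ℤ) (t : ℝ) (n p : ℤ) :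
    densityTerm a l t n * conj (densityTerm a l t (n - p)) =
      corrTerm a l p n * Complex.exp (-(2 * Complex.I * l * p * t)) := by
  have e : ∀ x y p q r s : ℂ, p * q * Complex.exp x * (r * s * Complex.exp y) =
      p * q * r * s * Complex.exp (x + y) := fun x y p q r s => by rw [Complex.exp_add]; ring
  simp only [densityTerm, map_mul, ← Complex.exp_conj, Complex.conj_conj, Complex.conj_ofReal,
    Complex.conj_I, corrTerm]
  rw [e]
  congr 2
  push_cast
  ring

theorem hasSum_sq_densityCoeff (ha : Summable fun n => ‖a n‖ ^ 2) (l : ℤ) (t : ℝ) :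
    HasSum (fun r : ℤ × ℤ => corrTerm a l r.2 r.1 * Complex.exp (-(2 * Complex.I * l * r.2 * t)))
      ((‖densityCoeff a l t‖ ^ 2 : ℝ) : ℂ) := by
  have hfs : Summable fun n => ‖densityTerm a l t n‖ := by
    simpa only [densityTerm, norm_exp_mul] using summable_norm_mul_conj_shift ha l
  have h1 : HasSum (densityTerm a l t) (densityCoeff a l t) := hfs.of_norm.hasSum
  have hcs : Summable fun n => ‖conj (densityTerm a l t n)‖ := by
    simpa only [RCLike.norm_conj] using hfs
  have h2 : HasSum (fun n => conj (densityTerm a l t n)) (conj (densityCoeff a l t)) := h1.star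
  have h3 := hasSum_mul_prod h1 h2 hfs hcs
  rw [Complex.mul_conj, Complex.normSq_eq_norm_sq] at h3
  refine (subEquiv.hasSum_iff.2 h3).congr_fun fun r => ?_
  exact (densityTerm_mul_conj a l t r.1 r.2).symm

theorem hasSum_integral_sq_densityCoeff (ha : Summable fun n => ‖a n‖ ^ 2) (B : ℝ) (l : ℤ) :
    HasSum (fun r : ℤ × ℤ => corrTerm a l r.2 r.1 * osc B l r.2)
      ((∫ t in (0 : ℝ)..B, ‖densityCoeff a l t‖ ^ 2 : ℝ) : ℂ) := by
  have h := intervalIntegral.hasSum_integral_of_dominated_convergence (μ := volume)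
    (a := 0) (b := B)
    (F := fun (r : ℤ × ℤ) (t : ℝ) =>
      corrTerm a l r.2 r.1 * Complex.exp (-(2 * Complex.I * l * r.2 * t)))
    (f := fun t => ((‖densityCoeff a l t‖ ^ 2 : ℝ) : ℂ))
    (fun r _ => ‖corrTerm a l r.2 r.1‖)
    (fun r => Continuous.aestronglyMeasurable (by fun_prop))
    (fun r => ae_of_all _ fun t _ => by
      have : -(2 * Complex.I * l * r.2 * t) = ((-(2 * l * r.2 * t) : ℝ) : ℂ) * Complex.I := by
        push_cast; ring
      rw [this, norm_exp_mul])
    (ae_of_all _ fun t _ => summable_corrTerm_prod ha l)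
    intervalIntegrable_const
    (ae_of_all _ fun t _ => hasSum_sq_densityCoeff ha l t)
  simp only [intervalIntegral.integral_const_mul] at h
  rwa [intervalIntegral.integral_ofReal] at h

theorem hasSum_corr (ha : Summable fun n => ‖a n‖ ^ 2) (q : ℤ × ℤ) :
    HasSum (corrTerm a q.1 q.2) (corr a q) :=
  (summable_corrTerm ha q.1 q.2).of_norm.hasSum

theorem hasSum_corr_zero_left (ha : Summable fun n => ‖a n‖ ^ 2) :
    HasSum (fun p => corr a (0, p)) ((mass a ^ 2 : ℝ) : ℂ) := by
  have h2 := ha.mul_of_nonneg ha (fun n => by positivity) (fun n => by positivity)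
  have h3 := subEquiv.hasSum_iff.2 (ha.hasSum.mul ha.hasSum h2)
  have h4 : HasSum (fun r : ℤ × ℤ => corrTerm a 0 r.2 r.1) ((mass a ^ 2 : ℝ) : ℂ) := by
    rw [sq]
    refine (Complex.hasSum_ofReal.2 h3).congr_fun fun r => ?_
    simp only [Function.comp, subEquiv, Equiv.coe_fn_mk, corrTerm, sub_zero]
    push_cast
    rw [← Complex.mul_conj', ← Complex.conj_mul']
    ring
  have h5 : HasSum (fun r : ℤ × ℤ => corrTerm a 0 r.1 r.2) ((mass a ^ 2 : ℝ) : ℂ) :=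
    (Equiv.prodComm ℤ ℤ).hasSum_iff.2 h4
  exact h5.prod_fiberwise fun p => hasSum_corr ha (0, p)

theorem corr_swap (a : ℤ → ℂ) (l p : ℤ) : corr a (l, p) = corr a (p, l) := by
  refine tsum_congr fun n => ?_
  simp only [corrTerm]
  rw [sub_right_comm n l p]
  ring

theorem corr_zero (a : ℤ → ℂ) : corr a 0 = ((∑' n, ‖a n‖ ^ 4 : ℝ) : ℂ) := by
  rw [Complex.ofReal_tsum]
  refine tsum_congr fun n => ?_
  simp only [corrTerm, Prod.fst_zero, Prod.snd_zero, sub_zero]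
  rw [show a n * conj (a n) * conj (a n) * a n = (a n * conj (a n)) ^ 2 by ring,
    Complex.mul_conj']
  push_cast
  ring

/-- The double count of the degenerate parallelograms `l = 0` and `p = 0` gives `2 (∑ |a n|²)²`; the
remaining ones, corrected at the origin, form the quartic functional with coefficients
`kernelCoeff`. -/
theorem hasSum_integral_densityCoeff (ha : Summable fun n => ‖a n‖ ^ 2) {B : ℝ} (hB : B ≠ 0) :
    HasSum (fun l => ∫ t in (0 : ℝ)..B, ‖densityCoeff a l t‖ ^ 2)
      (B * (2 * mass a ^ 2 + quartic (kernelCoeff B) a)) := by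
  have hk := (summable_mul_corr (summable_sq_kernelCoeff B) ha).of_norm
  have h0 := hasSum_corr_zero_left ha
  have hw : ∀ l : ℤ, ((∫ t in (0 : ℝ)..B, ‖densityCoeff a l t‖ ^ 2 : ℝ) : ℂ) =
      B * (∑' p, kernelCoeff B (l, p) * corr a (l, p) +
        (if l = 0 then ((mass a ^ 2 : ℝ) : ℂ) else 0) + corr a (l, 0)) := by
    intro l
    have h1 : HasSum (fun r : ℤ × ℤ => corrTerm a l r.1 r.2 * osc B l r.1)
        ((∫ t in (0 : ℝ)..B, ‖densityCoeff a l t‖ ^ 2 : ℝ) : ℂ) :=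
      (Equiv.prodComm ℤ ℤ).hasSum_iff.2 (hasSum_integral_sq_densityCoeff ha B l)
    have h1' : ∀ p, HasSum (fun n => corrTerm a l p n * osc B l p) (corr a (l, p) * osc B l p) :=
      fun p => (hasSum_corr ha (l, p)).mul_right _
    have h2 : HasSum (fun p => corr a (l, p) * osc B l p)
        ((∫ t in (0 : ℝ)..B, ‖densityCoeff a l t‖ ^ 2 : ℝ) : ℂ) :=
      h1.prod_fiberwise h1'
    refine h2.unique ?_
    have g1 := (hk.prod_factor l).hasSum
    have g2 : HasSum (fun p => if l = 0 then corr a (l, p) else 0)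
        (if l = 0 then ((mass a ^ 2 : ℝ) : ℂ) else 0) := by
      split_ifs with h
      · subst h; exact h0
      · exact hasSum_zero
    have g3 := hasSum_ite_eq (0 : ℤ) (corr a (l, 0))
    refine (((g1.add g2).add g3).mul_left (B : ℂ)).congr_fun fun p => ?_
    rw [osc_eq_kernelCoeff hB]
    by_cases hl : l = 0 <;> by_cases hp : p = 0 <;> simp [hl, hp] <;> ring
  have g1 := hk.hasSum.prod_fiberwise fun l => (hk.prod_factor l).hasSum
  have g2 := hasSum_ite_eq (0 : ℤ) ((mass a ^ 2 : ℝ) : ℂ)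
  have g3 : HasSum (fun l => corr a (l, 0)) ((mass a ^ 2 : ℝ) : ℂ) :=
    h0.congr_fun fun l => corr_swap a l 0
  have g4 := ((g1.add g2).add g3).mul_left (B : ℂ)
  have g5 := Complex.hasSum_re (g4.congr_fun hw)
  simp only [Complex.ofReal_re, Complex.re_ofReal_mul, Complex.add_re] at g5
  rwa [show B * (2 * mass a ^ 2 + quartic (kernelCoeff B) a) =
    B * ((∑' q, kernelCoeff B q * corr a q).re + mass a ^ 2 + mass a ^ 2) by rw [quartic]; ring]

end Density

theorem fhat_evol_mul_conj (u : L2T) (t : ℝ) (n l : ℤ) :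
    fhat (evol t u) n * conj (fhat (evol t u) (n - l)) = fhat u n * conj (fhat u (n - l)) *
      Complex.exp (((-(((n : ℝ) ^ 2 - ((n - l : ℤ) : ℝ) ^ 2) * t) : ℝ) : ℂ) * Complex.I) := by
  rw [fhat_evol, fhat_evol, map_mul, ← Complex.exp_conj, mul_mul_mul_comm, ← Complex.exp_add,
    mul_comm]
  congr 2
  simp only [map_neg, map_mul, map_pow, Complex.conj_I, Complex.conj_ofReal, map_intCast]
  push_cast
  ring

theorem lintegral_evol_pow_four (u : L2T) (t : ℝ) :
    ∫⁻ x : Torus, ‖evol t u x‖ₑ ^ 4 =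
      ENNReal.ofReal (2 * π) * ∑' l, ‖densityCoeff (fhat u) l t‖ₑ ^ 2 := by
  have hv := lintegral_smul_measure (μ := AddCircle.haarAddCircle) (ENNReal.ofReal (2 * π))
    fun x : Torus => ‖evol t u x‖ₑ ^ 4
  rw [← AddCircle.volume_eq_smul_haarAddCircle, smul_eq_mul] at hv
  rw [hv]
  have h := lintegral_enorm_pow_four_eq_tsum (Lp.memLp (evol t u)).haarAddCircle
  change _ = ∑' l, ‖∑' n, fhat (evol t u) n * conj (fhat (evol t u) (n - l))‖ₑ ^ 2 at h
  simp_rw [fhat_evol_mul_conj] at h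
  rw [h]
  rfl

/-- The Strichartz integral, in terms of Fourier coefficients. -/
theorem W_eq {B : ℝ} (hB : 0 < B) (u : L2T) :
    W B u = ENNReal.ofReal
      (2 * π * (B * (2 * mass (fhat u) ^ 2 + quartic (kernelCoeff B) (fhat u)))) := by
  have ha := summable_sq_fhat u
  have hsum := hasSum_integral_densityCoeff ha hB.ne'
  have hcont := fun l => (continuous_densityCoeff ha l)
  have h1 : ∀ l, ∫⁻ t in Set.Icc 0 B, ‖densityCoeff (fhat u) l t‖ₑ ^ 2 =
      ENNReal.ofReal (∫ t in (0 : ℝ)..B, ‖densityCoeff (fhat u) l t‖ ^ 2) := fun l => by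
    simp_rw [enorm_sq_eq_ofReal]
    rw [intervalIntegral.integral_of_le hB.le, ← integral_Icc_eq_integral_Ioc,
      ofReal_integral_eq_lintegral_ofReal _ (ae_of_all _ fun t => by positivity)]
    exact ((hcont l).norm.pow 2).integrableOn_Icc
  simp_rw [W, lintegral_evol_pow_four]
  have hm : ∀ l, Measurable fun t => ‖densityCoeff (fhat u) l t‖ₑ ^ 2 := fun l =>
    ((hcont l).measurable.enorm).pow_const 2
  rw [lintegral_const_mul _ (Measurable.tsum hm), lintegral_tsum fun l => (hm l).aemeasurable]
  simp_rw [h1]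
  rw [← ENNReal.ofReal_tsum_of_nonneg _ hsum.summable, hsum.tsum_eq,
    ← ENNReal.ofReal_mul Real.two_pi_pos.le]
  exact fun l => intervalIntegral.integral_nonneg hB.le fun t _ => by positivity

/-- The functional `A_B` is the quartic functional with coefficients `kernelCoeff B`. -/
theorem A_eq_quartic {B : ℝ} (hB : 0 < B) (u : L2T) :
    A B u = quartic (kernelCoeff B) (fhat u) := by
  have ha := summable_sq_fhat u
  have hB' : (B : ℂ) ≠ 0 := by exact_mod_cast hB.ne'
  set a := fhat u with hadef
  let e : ({l : ℤ // l ≠ 0} × {p : ℤ // p ≠ 0}) × ℤ ≃ {l : ℤ // l ≠ 0} × ℤ × {p : ℤ // p ≠ 0} :=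
    { toFun := fun q => (q.1.1, q.2, q.1.2)
      invFun := fun q => ((q.1, q.2.2), q.2.1)
      left_inv := fun _ => rfl
      right_inv := fun _ => rfl }
  let i : {l : ℤ // l ≠ 0} × {p : ℤ // p ≠ 0} → ℤ × ℤ := fun q => (q.1, q.2)
  have hi : Function.Injective i := fun q r h => by
    simp only [i, Prod.mk.injEq] at h
    exact Prod.ext (Subtype.ext h.1) (Subtype.ext h.2)
  -- the sum over nondegenerate parallelograms, arranged by their sides
  have hD : HasSum (fun q => kernelCoeff B (i q) * corr a (i q)) (D B u / (2 * π * B)) := by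
    have h1 : HasSum (fun q : {l : ℤ // l ≠ 0} × ℤ × {p : ℤ // p ≠ 0} =>
        dTerm B u q.1 q.2.1 q.2.2) (D B u / (2 * π)) := by
      have h := (summable_dTerm B u).of_norm.hasSum
      rwa [D, mul_div_cancel_left₀ _ (by simp [Real.pi_ne_zero])]
    have h2 := e.hasSum_iff.2 h1
    have h2' : ∀ q : {l : ℤ // l ≠ 0} × {p : ℤ // p ≠ 0},
        HasSum (fun n => corrTerm a q.1 q.2 n * osc B q.1 q.2) (corr a (i q) * osc B q.1 q.2) :=
      fun q => (hasSum_corr ha (i q)).mul_right _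
    have h3 : HasSum (fun q : {l : ℤ // l ≠ 0} × {p : ℤ // p ≠ 0} =>
        corr a (i q) * osc B q.1 q.2) (D B u / (2 * π)) := h2.prod_fiberwise h2'
    rw [← div_div]
    refine (h3.div_const (B : ℂ)).congr_fun fun q => ?_
    have : kernelCoeff B (i q) = osc B q.1 q.2 / B := by
      simp [kernelCoeff, i, q.1.2, q.2.2]
    rw [this]
    ring
  have h4 : HasSum (fun q => kernelCoeff B q * corr a q)
      (D B u / (2 * π * B) + kernelCoeff B 0 * corr a 0) := by
    have g1 : HasSum (fun q => if q = 0 then 0 else kernelCoeff B q * corr a q)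
        (D B u / (2 * π * B)) := by
      refine (hi.hasSum_iff (fun q hq => ?_)).1 (hD.congr_fun fun q => ?_)
      · simp only [kernelCoeff]
        split_ifs with h0 h1
        · rfl
        · exact zero_mul _
        · push Not at h1
          exact absurd ⟨(⟨q.1, h1.1⟩, ⟨q.2, h1.2⟩), rfl⟩ hq
      · have : i q ≠ 0 := fun h => q.1.2 (congrArg Prod.fst h)
        simp [this]
    refine (g1.add (hasSum_ite_eq (0 : ℤ × ℤ) (kernelCoeff B 0 * corr a 0))).congr_fun fun q => ?_
    by_cases h : q = 0 <;> simp [h]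
  rw [A, quartic, h4.tsum_eq, corr_zero]
  have e1 : D B u / (2 * π * B) = D B u / ((2 * π * B : ℝ) : ℂ) := by push_cast; rfl
  rw [e1, Complex.add_re, Complex.div_ofReal_re]
  simp [kernelCoeff, sub_eq_add_neg, hadef]

theorem sq_norm_eq_mass (u : L2T) : ‖u‖ ^ 2 = 2 * π * mass (fhat u) := by
  have h1 := tsum_sq_fourierCoeff (toHaar u)
  have h2 : fourierCoeff (toHaar u) = fhat u :=
    fourierCoeff_congr_ae (Lp.memLp u).haarAddCircle.coeFn_toLp
  have h3 : ∫ x, ‖toHaar u x‖ ^ 2 ∂AddCircle.haarAddCircle =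
      ∫ x, ‖u x‖ ^ 2 ∂AddCircle.haarAddCircle :=
    integral_congr_ae ((Lp.memLp u).haarAddCircle.coeFn_toLp.mono fun x hx => by
      rw [toHaar]; simp only [hx])
  rw [h2, h3, AddCircle.integral_haarAddCircle] at h1
  rw [mass, h1, smul_eq_mul, mul_inv_cancel_left₀ Real.two_pi_pos.ne']
  have h4 : inner ℂ u u = ∫ x, inner ℂ (u x) (u x) := L2.inner_def u u
  have h5 : ((‖u‖ ^ 2 : ℝ) : ℂ) = ((∫ x : Torus, ‖u x‖ ^ 2 : ℝ) : ℂ) := by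
    rw [← integral_complex_ofReal]
    simp only [inner_self_eq_norm_sq_to_K] at h4
    push_cast
    exact h4
  exact_mod_cast h5

/-- Every `ℓ²` sequence is the sequence of Fourier coefficients of an `L²` function. -/
theorem exists_fhat_eq {a : ℤ → ℂ} (ha : Summable fun n => ‖a n‖ ^ 2) :
    ∃ u : L2T, fhat u = a := by
  refine ⟨ofHaar (fourierBasis.repr.symm ⟨a, memℓp_gen (by simpa using ha)⟩), funext fun n => ?_⟩
  rw [fhat_ofHaar, LinearIsometryEquiv.apply_symm_apply]

/-! ### Spread-out sequences without parallelograms -/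

theorem eq_of_two_pow_add_eq {i j k m : ℕ} (hm : m ≤ i) (hk : k ≤ j)
    (h : 2 ^ i + 2 ^ m = 2 ^ j + 2 ^ k) : i = j := by
  have key : ∀ {i j k m : ℕ}, k ≤ j → 2 ^ i + 2 ^ m = 2 ^ j + 2 ^ k → ¬ j < i := by
    intro i j k m hk h hji
    have h1 : 2 ^ (j + 1) ≤ 2 ^ i := Nat.pow_le_pow_right two_pos hji
    have h2 : 2 ^ k ≤ 2 ^ j := Nat.pow_le_pow_right two_pos hk
    have h3 : 0 < 2 ^ m := by positivity
    rw [pow_succ] at h1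
    omega
  exact le_antisymm (not_lt.1 (key hk h)) (not_lt.1 (key hm h.symm))

/-- The powers of two form a Sidon set. -/
theorem two_pow_sidon {i j k m : ℕ} (h : 2 ^ i + 2 ^ m = 2 ^ j + 2 ^ k) : i = j ∨ i = k := by
  have inj : ∀ {x y : ℕ}, 2 ^ x = 2 ^ y → x = y := fun h => Nat.pow_right_injective le_rfl h
  rcases le_total m i with h1 | h1 <;> rcases le_total k j with h2 | h2
  · exact Or.inl (eq_of_two_pow_add_eq h1 h2 h)
  · exact Or.inr (eq_of_two_pow_add_eq h1 h2 (h.trans (add_comm _ _)))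
  · have h3 := eq_of_two_pow_add_eq h1 h2 ((add_comm _ _).trans h)
    subst h3
    exact Or.inr (inj (by omega))
  · have h3 := eq_of_two_pow_add_eq h1 h2 ((add_comm _ _).trans (h.trans (add_comm _ _)))
    subst h3
    exact Or.inl (inj (by omega))

/-- The sequence of unit mass that is constant on the first `N` powers of two, and `0` elsewhere. -/
noncomputable def lacunary (N : ℕ) (n : ℤ) : ℂ :=
  if n ∈ (Finset.range N).image (fun k : ℕ => (2 : ℤ) ^ k) then ((√N)⁻¹ : ℝ) else 0

theorem exists_of_lacunary_ne_zero {N : ℕ} {n : ℤ} (h : lacunary N n ≠ 0) :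
    ∃ k : ℕ, n = 2 ^ k := by
  by_contra h1
  refine h (if_neg fun h2 => ?_)
  obtain ⟨k, -, hk⟩ := Finset.mem_image.1 h2
  exact h1 ⟨k, hk.symm⟩

theorem hasSum_norm_lacunary_pow (N : ℕ) {j : ℕ} (hj : j ≠ 0) :
    HasSum (fun n => ‖lacunary N n‖ ^ j) (N * (√N)⁻¹ ^ j) := by
  have hcard : ((Finset.range N).image fun k : ℕ => (2 : ℤ) ^ k).card = N := by
    rw [Finset.card_image_of_injective _ (pow_right_injective₀ two_pos (by norm_num)),
      Finset.card_range]
  have h : HasSum (fun n => ‖lacunary N n‖ ^ j)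
      (∑ n ∈ (Finset.range N).image (fun k : ℕ => (2 : ℤ) ^ k), ‖lacunary N n‖ ^ j) :=
    hasSum_sum_of_ne_finset_zero fun n hn => by
      rw [lacunary, if_neg hn, norm_zero, zero_pow hj]
  have e : ∀ n ∈ (Finset.range N).image (fun k : ℕ => (2 : ℤ) ^ k),
      ‖lacunary N n‖ ^ j = (√N)⁻¹ ^ j := fun n hn => by
    rw [lacunary, if_pos hn, Complex.norm_real, Real.norm_eq_abs, abs_of_nonneg (by positivity)]
  rwa [Finset.sum_congr rfl e, Finset.sum_const, hcard, nsmul_eq_mul] at h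

theorem summable_sq_lacunary (N : ℕ) : Summable fun n => ‖lacunary N n‖ ^ 2 :=
  (hasSum_norm_lacunary_pow N two_ne_zero).summable

theorem mass_lacunary {N : ℕ} (hN : 0 < N) : mass (lacunary N) = 1 := by
  have hN' : (0 : ℝ) < N := by exact_mod_cast hN
  rw [mass, (hasSum_norm_lacunary_pow N two_ne_zero).tsum_eq, inv_pow, Real.sq_sqrt hN'.le,
    mul_inv_cancel₀ hN'.ne']

theorem quartic_lacunary (B : ℝ) {N : ℕ} (hN : 0 < N) :
    quartic (kernelCoeff B) (lacunary N) = -(N : ℝ)⁻¹ := by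
  have hN' : (0 : ℝ) < N := by exact_mod_cast hN
  have h0 : ∀ q : ℤ × ℤ, q ≠ 0 → kernelCoeff B q * corr (lacunary N) q = 0 := by
    rintro ⟨l, p⟩ hq
    by_cases hlp : l = 0 ∨ p = 0
    · simp [kernelCoeff, hq, hlp]
    -- a nondegenerate parallelogram of powers of two would violate the Sidon property
    have : corr (lacunary N) (l, p) = 0 := by
      rw [corr]
      convert! tsum_zero with n
      by_contra h
      simp only [corrTerm, mul_eq_zero, not_or, map_eq_zero] at h
      obtain ⟨⟨⟨h1, h2⟩, h3⟩, h4⟩ := h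
      obtain ⟨i, hi⟩ := exists_of_lacunary_ne_zero h1
      obtain ⟨j, hj⟩ := exists_of_lacunary_ne_zero h2
      obtain ⟨k, hk⟩ := exists_of_lacunary_ne_zero h3
      obtain ⟨m, hm⟩ := exists_of_lacunary_ne_zero h4
      have e : (2 : ℤ) ^ i + 2 ^ m = 2 ^ j + 2 ^ k := by linarith
      have e' : 2 ^ i + 2 ^ m = 2 ^ j + 2 ^ k := by exact_mod_cast e
      rcases two_pow_sidon e' with rfl | rfl
      · exact hlp (Or.inl (by linarith))
      · exact hlp (Or.inr (by linarith))
    rw [this, mul_zero]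
  rw [quartic, tsum_eq_single 0 h0, corr_zero,
    (hasSum_norm_lacunary_pow N four_ne_zero).tsum_eq, Complex.re_mul_ofReal]
  have h4 : (√N : ℝ)⁻¹ ^ 4 = (N : ℝ)⁻¹ ^ 2 := by
    rw [show (√N : ℝ)⁻¹ ^ 4 = ((√N)⁻¹ ^ 2) ^ 2 by ring, inv_pow, Real.sq_sqrt hN'.le]
  rw [h4]
  simp only [kernelCoeff, if_true, Complex.neg_re, Complex.one_re]
  field_simp

/-! ### Attainment and non-attainment of the Strichartz constant -/

theorem mass_fhat_of_norm {u : L2T} (hu : ‖u‖ ^ 2 = 1) : mass (fhat u) = (2 * π)⁻¹ := by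
  rw [sq_norm_eq_mass] at hu
  exact eq_inv_of_mul_eq_one_right hu

theorem W_eq_of_norm {B : ℝ} (hB : 0 < B) {u : L2T} (hu : ‖u‖ ^ 2 = 1) :
    W B u = ENNReal.ofReal (B / π + 2 * π * B * A B u) := by
  rw [W_eq hB, mass_fhat_of_norm hu, A_eq_quartic hB]
  congr 1
  have := Real.pi_ne_zero
  field_simp

/-- A sequence of unit mass gives a function of unit `L²` norm. -/
theorem exists_norm_eq_one_and_A_eq {B : ℝ} (hB : 0 < B) {a : ℤ → ℂ}
    (ha : Summable fun n => ‖a n‖ ^ 2) (hm : mass a = 1) :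
    ∃ u : L2T, ‖u‖ ^ 2 = 1 ∧ A B u = quartic (kernelCoeff B) a * (2 * π)⁻¹ ^ 2 := by
  have hc : (√(2 * π))⁻¹ ^ 2 = (2 * π)⁻¹ := by rw [inv_pow, Real.sq_sqrt Real.two_pi_pos.le]
  obtain ⟨u, hu⟩ := exists_fhat_eq (summable_sq_real_mul ha (√(2 * π))⁻¹)
  refine ⟨u, ?_, ?_⟩
  · rw [sq_norm_eq_mass, hu, mass_real_mul, hm, hc, mul_one, mul_inv_cancel₀ Real.two_pi_pos.ne']
  · rw [A_eq_quartic hB, hu, quartic_real_mul, show (√(2 * π))⁻¹ ^ 4 = ((√(2 * π))⁻¹ ^ 2) ^ 2 by ring,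
      hc, mul_comm]

/-- Lacunary sequences show that the constant is never below `B / π`. -/
theorem ofReal_le_J {B : ℝ} (hB : 0 < B) : ENNReal.ofReal (B / π) ≤ J B 1 := by
  have hlim : Tendsto (fun N : ℕ => ENNReal.ofReal
      (B / π + 2 * π * B * (-(N : ℝ)⁻¹ * (2 * π)⁻¹ ^ 2))) atTop (𝓝 (ENNReal.ofReal (B / π))) := by
    refine (ENNReal.continuous_ofReal.tendsto _).comp ?_
    have h := (((tendsto_inv_atTop_nhds_zero_nat (𝕜 := ℝ)).neg.mul_const
      ((2 * π)⁻¹ ^ 2)).const_mul (2 * π * B)).const_add (B / π)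
    simpa using h
  refine le_of_tendsto hlim ((eventually_gt_atTop 0).mono fun N hN => ?_)
  obtain ⟨u, hu, hA⟩ := exists_norm_eq_one_and_A_eq hB (summable_sq_lacunary N) (mass_lacunary hN)
  rw [← quartic_lacunary B hN, ← hA, ← W_eq_of_norm hB hu]
  exact le_sSup ⟨u, hu, rfl⟩

theorem exists_maximizer_of_A_pos {B : ℝ} (hB : 0 < B) {w : L2T} (hw : 0 < A B w) :
    ENNReal.ofReal (B / π) < J B 1 ∧ J B 1 < ⊤ ∧ ∃ u₀ : L2T, IsMaximizer B 1 u₀ := by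
  have hκ := summable_sq_kernelCoeff B
  rw [A_eq_quartic hB] at hw
  obtain ⟨a, ha, hm, hmax⟩ := exists_quartic_maximizer hκ (summable_sq_fhat w) hw
  have hpos : 0 < quartic (kernelCoeff B) a := by
    have h1 := hw.trans_le (quartic_le_mul_sq_mass hmax hκ (summable_sq_fhat w))
    by_contra h2
    nlinarith [sq_nonneg (mass (fhat w))]
  obtain ⟨u, hu, hA⟩ := exists_norm_eq_one_and_A_eq hB ha hm
  have hJ : W B u = J B 1 := by
    refine le_antisymm (le_sSup ⟨u, hu, rfl⟩) (sSup_le ?_)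
    rintro _ ⟨v, hv, rfl⟩
    rw [W_eq_of_norm hB hu, W_eq_of_norm hB hv]
    refine ENNReal.ofReal_le_ofReal ?_
    have h := quartic_le_mul_sq_mass hmax hκ (summable_sq_fhat v)
    rw [mass_fhat_of_norm hv, ← hA, ← A_eq_quartic hB] at h
    gcongr
  have hApos : 0 < A B u := by rw [hA]; positivity
  have hBπ : 0 < B / π := div_pos hB Real.pi_pos
  refine ⟨?_, ?_, u, hu, hJ⟩
  · rw [← hJ, W_eq_of_norm hB hu]
    exact (ENNReal.ofReal_lt_ofReal_iff (by positivity)).2 (lt_add_of_pos_right _ (by positivity))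
  · rw [← hJ, W_eq_of_norm hB hu]
    exact ENNReal.ofReal_lt_top

theorem W_lt_of_A_neg {B : ℝ} (hB : 0 < B) {u : L2T} (hu : ‖u‖ ^ 2 = 1) (hA : A B u < 0) :
    W B u < ENNReal.ofReal (B / π) := by
  rw [W_eq_of_norm hB hu]
  have hc : 0 < 2 * π * B := by positivity
  exact (ENNReal.ofReal_lt_ofReal_iff (div_pos hB Real.pi_pos)).2 (by nlinarith)

end PeriodicStrichartz

theorem mainTheorem2 (B : ℝ) (hB : 0 < B) :
    ((∃ w : PeriodicStrichartz.L2T, 0 < PeriodicStrichartz.A B w) →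
      ENNReal.ofReal (B / Real.pi) < PeriodicStrichartz.J B 1 ∧
      PeriodicStrichartz.J B 1 < ⊤ ∧
      ∃ u₀ : PeriodicStrichartz.L2T, PeriodicStrichartz.IsMaximizer B 1 u₀) ∧
    ((∀ u : PeriodicStrichartz.L2T, u ≠ 0 → PeriodicStrichartz.A B u < 0) →
      PeriodicStrichartz.J B 1 = ENNReal.ofReal (B / Real.pi) ∧
      ¬ ∃ u₀ : PeriodicStrichartz.L2T, PeriodicStrichartz.IsMaximizer B 1 u₀) := by
  refine ⟨fun ⟨w, hw⟩ => PeriodicStrichartz.exists_maximizer_of_A_pos hB hw, fun hA => ?_⟩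
  have hlt : ∀ u : PeriodicStrichartz.L2T, ‖u‖ ^ 2 = 1 →
      PeriodicStrichartz.W B u < ENNReal.ofReal (B / Real.pi) := fun u hu =>
    PeriodicStrichartz.W_lt_of_A_neg hB hu (hA u (by rintro rfl; simp at hu))
  have hJ : PeriodicStrichartz.J B 1 = ENNReal.ofReal (B / Real.pi) := by
    refine le_antisymm (sSup_le ?_) (PeriodicStrichartz.ofReal_le_J hB)
    rintro _ ⟨u, hu, rfl⟩
    exact (hlt u hu).le
  exact ⟨hJ, fun ⟨u, hu, hW⟩ => (hlt u hu).ne (hW.trans hJ)⟩
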